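/- **Setting.** A principal faces $K\ge 1$ arms and $N\ge1$ agents over slots $t=1,\dots,T$, $T\ge1$. The reward vectors $\boldsymbol r^t\in[0,1]^K$ are IID over $t$ with mean $\bar{\boldsymbol r}$; the matrices of private costs $\boldsymbol c^t=(c^t_{n,k})\in[c_{\min},1]^{N\times K}$, $c_{\min}\ge0$, are IID over $t$; rewards and costs are independent of each other. Let $\mathcal X$ be the set of $\boldsymbol x\in\{0,1\}^{N\times K}$ with all row sums and all column sums at most $1$. For decisions $\boldsymbol a\in\{0,1\}^N$ put $f_n(\boldsymbol x,\boldsymbol a)=\sum_k x_{n,k}a_n$, $V(\boldsymbol x,\boldsymbol a;\boldsymbol r)=\sum_{k,n}r_kx_{n,k}a_n$ and $S(\boldsymbol x,\boldsymbol a;\boldsymbol r,\boldsymbol c)=V(\boldsymbol x,\boldsymbol a;\boldsymbol r)-\sum_{n,k}c_{n,k}x_{n,k}a_n$. Let $\phi_n\in[0,1]$ be given utilization ratios, $\Phi=\sum_n\phi_n$, $\phi_{\min}=\min_n\phi_n$, $\Theta=\min(K+\Phi,N)$, and for $\delta\in(0,\phi_{\min})$ $$\Xi(\delta)=\frac{3\sqrt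 N\,\Theta^2}{\phi_{\min}-\delta}\ln\Big(\frac{2\Theta}{\phi_{\min}-\delta}\Big)+\frac{3\sqrt N\,\Theta}{2\delta}.$$ **Mechanism $\mathfrak A$.** Start from $\boldsymbol\lambda^1=\boldsymbol 0$, $H^0_k=0$. In slot $t$ each agent $n$ bids its costs (truthfully, so that the bids are $\boldsymbol c^t$). With $H_k^{t-1}$ the number of pulls of arm $k$ before slot $t$ and $\tilde r_k^{t-1}$ the average of the rewards then observed, let $\hat r_k^t=\min\big(\tilde r_k^{t-1}+\sqrt{3\ln t/(2H_k^{t-1})},1\big)$ if $H_k^{t-1}>0$ and $\hat r_k^t=1$ otherwise. The assignment $\boldsymbol x^t$ is a maximizer (ties broken by any fixed measurable rule depending on $t$, the multipliers, the estimates and the bids) over $\boldsymbol x\in\mathcal X$ of $$\sum_{n,k}(\hat r_k^t-c_{n,k}^t)x_{n,k}-\sum_n\lambda_n^t\Big(\sum_kx_{n,k}-\phi_n\Big).$$ Agent $n$ is offered the payment $y_n^t=\sum_k(\hat r_k^t-\lambda_n^t)x_{n,k}^t-\big[\max_{\boldsymbol x\in\mathcal X}\mathcal L_{-n}(\boldsymbol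 x)-\mathcal L_{-n}(\boldsymbol x^t)\big]$, where $\mathcal L_{-n}(\boldsymbol x)=\sum_k\sum_{i\ne n}(\hat r^t_k-c^t_{i,k}-\lambda^t_i)x_{i,k}+\sum_i\lambda^t_i\phi_i$, and follows the proposal ($a_n^t=1$) if $y^t_n\ge\sum_kc^t_{n,k}x^t_{n,k}$ and declines ($a_n^t=0$) otherwise. Finally $\lambda_n^{t+1}=\max\big(\lambda_n^t+\eta(\sum_kx^t_{n,k}-\phi_n),0\big)$. **Measures.** Let $S^*$ be the maximum (supremum) of $\mathbb E\big[\sum_{k,n}(\bar r_k-c_{n,k})x_{n,k}(\boldsymbol c)\big]$ over measurable policies $\boldsymbol c\mapsto\boldsymbol x(\boldsymbol c)\in\mathcal X$ with $\mathbb E[\sum_kx_{n,k}(\boldsymbol c)]\le\phi_n$ for all $n$, where $\boldsymbol c$ has the law of $\boldsymbol c^1$. Put $$\mathtt{Reg}(T)=\sum_{t=1}^T\big(S^*-\mathbb E[S(\boldsymbol x^t,\boldsymbol a^t;\boldsymbol r^t,\boldsymbol c^t)]\big),\quad \mathtt{Vio}(T)=\sum_{n=1}^N\mathbb E\Big(\sum_{t=1}^T[f_n(\boldsymbol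 x^t,\boldsymbol a^t)-\phi_n]\Big)^+,\quad \mathtt{Pro}(T)=\sum_{t=1}^T\mathbb E\Big[V(\boldsymbol x^t,\boldsymbol a^t;\boldsymbol r^t)-\sum_na^t_ny^t_n\Big].$$ **Theorem.** With the step size $\eta=\dfrac{4K+2\sqrt{6KT\Phi\ln T}}{T\Theta}$, mechanism $\mathfrak A$ satisfies $$\mathtt{Reg}(T)\le 6K+3\sqrt{6KT\Big[\Phi+\frac{\mathtt{Vio}(T)}{T}\Big]\ln T},$$ $$\mathtt{Vio}(T)\le\Xi(\delta)+\frac{\Theta^2}{4\delta}\sqrt{\frac{NT}{K\Phi}}\qquad\text{for every }\delta\in(0,\phi_{\min}),$$ $$\mathtt{Pro}(T)+\frac{5K}{2}+2\sqrt{6KT\Big[\Phi+\frac{\mathtt{Vio}(T)}{T}\Big]\ln T}\ge0.$$ -/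

import Mathlib

open MeasureTheory ProbabilityTheory

noncomputable section

namespace IOL

/-- Real `N × K` matrices: rows are agents, columns are arms. -/
abbrev Mat (N K : ℕ) : Type := Fin N → Fin K → ℝ

/-- The set of admissible assignments: 0/1 matrices in which every agent pulls at most one arm
and every arm is pulled at most once. -/
def assignments (N K : ℕ) : Set (Mat N K) :=
  {x | (∀ n k, x n k = 0 ∨ x n k = 1) ∧ (∀ n, ∑ k, x n k ≤ 1) ∧ (∀ k, ∑ n, x n k ≤ 1)}

variable {N K : ℕ}

/-! ### The model: payoffs, reward, cost, welfare -/

/-- Utilization `f_n(x, a)` of agent `n`. -/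
def utilization (x : Mat N K) (a : Fin N → ℝ) (n : Fin N) : ℝ := ∑ k, x n k * a n

/-- Principal's reward `V(x, a; r)`. -/
def reward (x : Mat N K) (a : Fin N → ℝ) (r : Fin K → ℝ) : ℝ := ∑ k, ∑ n, r k * x n k * a n

/-- Agents' total cost `C(x, a; c)`. -/
def cost (x : Mat N K) (a : Fin N → ℝ) (c : Mat N K) : ℝ := ∑ n, ∑ k, c n k * x n k * a n

/-- Social welfare `S(x, a; r, c)`. -/
def welfare (x : Mat N K) (a : Fin N → ℝ) (r : Fin K → ℝ) (c : Mat N K) : ℝ :=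
  reward x a r - cost x a c

/-- Payoff `U_n(α, x, y)` of agent `n` with true costs `c`, when its decision is `α`. -/
def payoff (c x : Mat N K) (y : Fin N → ℝ) (n : Fin N) (α : ℝ) : ℝ :=
  (y n - ∑ k, c n k * x n k) * α

/-- The payoff-maximizing decision of each agent on a proposal `(x, y)`: it follows (`1`) if
following gives at least the payoff of declining, and declines (`0`) otherwise. -/
def decision (c x : Mat N K) (y : Fin N → ℝ) (n : Fin N) : ℝ :=
  open Classical in if payoff c x y n 0 ≤ payoff c x y n 1 then 1 else 0

/-! ### Lagrangian and payments -/

/-- The Lagrangian `L(x, lam; rhat, chat)`. -/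
def lagrangian (φ lam : Fin N → ℝ) (rhat : Fin K → ℝ) (chat x : Mat N K) : ℝ :=
  welfare x 1 rhat chat - ∑ n, lam n * (utilization x 1 n - φ n)

/-- The Lagrangian `L_{-n}` in the absence of agent `n`. -/
def lagrangianWithout (φ lam : Fin N → ℝ) (rhat : Fin K → ℝ) (chat : Mat N K) (n : Fin N)
    (x : Mat N K) : ℝ :=
  ∑ k, ∑ i ∈ Finset.univ.erase n, (rhat k - chat i k) * x i k
    - ∑ i ∈ Finset.univ.erase n, lam i * utilization x 1 i + ∑ i, lam i * φ i

/-- The maximum of `L_{-n}` over the (finite, nonempty) set of assignments. -/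
def maxLagrangianWithout (φ lam : Fin N → ℝ) (rhat : Fin K → ℝ) (chat : Mat N K) (n : Fin N) : ℝ :=
  sSup (lagrangianWithout φ lam rhat chat n '' assignments N K)

/-- The payment to agent `n` in the cost revelation auction, when the assignment is `x`. -/
def payment (φ lam : Fin N → ℝ) (rhat : Fin K → ℝ) (chat x : Mat N K) (n : Fin N) : ℝ :=
  ∑ k, (rhat k - lam n) * x n k
    - (maxLagrangianWithout φ lam rhat chat n - lagrangianWithout φ lam rhat chat n x)

/-! ### The mechanism -/

/-- An assignment rule: in slot `t` it turns multipliers, estimated rewards and bids into an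
assignment. -/
abbrev Rule (N K : ℕ) : Type := ℕ → (Fin N → ℝ) → (Fin K → ℝ) → Mat N K → Mat N K

/-- The rule always chooses a maximizer of the Lagrangian over the assignments, and is measurable;
ties are broken in an arbitrary way. -/
structure IsMaximizingRule (φ : Fin N → ℝ) (sel : Rule N K) : Prop where
  mem : ∀ t lam rhat chat, sel t lam rhat chat ∈ assignments N K
  isMax : ∀ t lam rhat chat, IsMaxOn (lagrangian φ lam rhat chat) (assignments N K)
    (sel t lam rhat chat)
  measurable : ∀ t, Measurable
    fun p : (Fin N → ℝ) × (Fin K → ℝ) × Mat N K => sel t p.1 p.2.1 p.2.2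

/-- What the mechanism stores at the end of slot `t`: the multipliers `lam^{t+1}`, the numbers of
observations `H^t` and the empirical average rewards `rtilde^t`. -/
structure State (N K : ℕ) where
  lam : Fin N → ℝ
  count : Fin K → ℝ
  avg : Fin K → ℝ

/-- The upper-confidence-bound estimate `rhat^t`, from the state `s` at the end of slot `t - 1`. -/
def estimate (t : ℕ) (s : State N K) (k : Fin K) : ℝ :=
  open Classical in
  if 0 < s.count k then min (s.avg k + √(3 * Real.log t / (2 * s.count k))) 1 else 1

/-- The assignment in slot `t`, from the state `s` at the end of slot `t - 1` and the bids. -/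
def slotAssignment (sel : Rule N K) (chat : Mat N K) (t : ℕ) (s : State N K) : Mat N K :=
  sel t s.lam (estimate t s) chat

/-- The payments in slot `t`, from the state `s` at the end of slot `t - 1` and the bids. -/
def slotPayment (φ : Fin N → ℝ) (sel : Rule N K) (chat : Mat N K) (t : ℕ) (s : State N K) :
    Fin N → ℝ :=
  payment φ s.lam (estimate t s) chat (slotAssignment sel chat t s)

/-- The agents' decisions in slot `t`, with true costs `c` and bids `chat`. -/
def slotDecision (φ : Fin N → ℝ) (sel : Rule N K) (chat c : Mat N K) (t : ℕ) (s : State N K) :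
    Fin N → ℝ :=
  decision c (slotAssignment sel chat t s) (slotPayment φ sel chat t s)

/-- The updates at the end of slot `t`. The partial derivative of the Lagrangian in `lam n` is
`-(f_n(x, 1) - φ n)`, and the projection onto the nonnegative orthant is `max · 0` in each
coordinate. -/
def update (φ : Fin N → ℝ) (η : ℝ) (sel : Rule N K) (chat c : Mat N K) (r : Fin K → ℝ) (t : ℕ)
    (s : State N K) : State N K :=
  let x := slotAssignment sel chat t s
  let a := slotDecision φ sel chat c t s
  { lam := fun n => max (s.lam n - η * (-(utilization x 1 n - φ n))) 0
    count := fun k => s.count k + ∑ n, x n k * a n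
    avg := fun k => (s.avg k * s.count k + r k * ∑ n, x n k * a n) /
      (s.count k + ∑ n, x n k * a n) }

/-- The state at the end of slot `t` along the realized bids `chat`, true costs `c` and rewards `r`
(slots are `1, 2, …`; the entries at `0` are never used). -/
def state (φ : Fin N → ℝ) (η : ℝ) (sel : Rule N K) (chat c : ℕ → Mat N K) (r : ℕ → Fin K → ℝ) :
    ℕ → State N K
  | 0 => ⟨0, 0, 0⟩
  | t + 1 => update φ η sel (chat (t + 1)) (c (t + 1)) (r (t + 1)) (t + 1) (state φ η sel chat c r t)

/-- The assignment of the mechanism in slot `t ≥ 1`. -/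
def xHat (φ : Fin N → ℝ) (η : ℝ) (sel : Rule N K) (chat c : ℕ → Mat N K) (r : ℕ → Fin K → ℝ)
    (t : ℕ) : Mat N K :=
  slotAssignment sel (chat t) t (state φ η sel chat c r (t - 1))

/-- The payments of the mechanism in slot `t ≥ 1`. -/
def yHat (φ : Fin N → ℝ) (η : ℝ) (sel : Rule N K) (chat c : ℕ → Mat N K) (r : ℕ → Fin K → ℝ)
    (t : ℕ) : Fin N → ℝ :=
  slotPayment φ sel (chat t) t (state φ η sel chat c r (t - 1))

/-- The agents' decisions under the mechanism in slot `t ≥ 1`. -/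
def aHat (φ : Fin N → ℝ) (η : ℝ) (sel : Rule N K) (chat c : ℕ → Mat N K) (r : ℕ → Fin K → ℝ)
    (t : ℕ) : Fin N → ℝ :=
  slotDecision φ sel (chat t) (c t) t (state φ η sel chat c r (t - 1))

/-! ### Benchmark and performance measures -/

/-- The benchmark `S*`: the largest expected welfare of a policy that knows the average rewards
`rbar` and observes the costs (of law `γ`), under the fairness constraints in expectation. -/
def benchmark (φ : Fin N → ℝ) (rbar : Fin K → ℝ) (γ : Measure (Mat N K)) : ℝ :=
  sSup {s | ∃ x : Mat N K → Mat N K, Measurable x ∧ (∀ c, x c ∈ assignments N K) ∧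
    (∀ n, ∫ c, utilization (x c) 1 n ∂γ ≤ φ n) ∧
    s = ∫ c, ∑ k, ∑ n, (rbar k - c n k) * x c n k ∂γ}

variable {Ω : Type*} [MeasurableSpace Ω]

/-- Cumulative regret `Reg(T)` of the assignments `x` and decisions `a` (slots `1, …, T`). -/
def regret (P : Measure Ω) (φ : Fin N → ℝ) (r : ℕ → Ω → Fin K → ℝ) (c : ℕ → Ω → Mat N K)
    (x : ℕ → Ω → Mat N K) (a : ℕ → Ω → Fin N → ℝ) (T : ℕ) : ℝ :=
  ∑ t ∈ Finset.Icc 1 T, (benchmark φ (fun k => ∫ ω, r 1 ω k ∂P) (P.map (c 1))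
    - ∫ ω, welfare (x t ω) (a t ω) (r t ω) (c t ω) ∂P)

/-- Cumulative fairness violation `Vio(T)`. -/
def violation (P : Measure Ω) (φ : Fin N → ℝ) (x : ℕ → Ω → Mat N K) (a : ℕ → Ω → Fin N → ℝ)
    (T : ℕ) : ℝ :=
  ∑ n, ∫ ω, max (∑ t ∈ Finset.Icc 1 T, (utilization (x t ω) (a t ω) n - φ n)) 0 ∂P

/-- Cumulative profit `Pro(T)` of the principal. -/
def profit (P : Measure Ω) (r : ℕ → Ω → Fin K → ℝ) (x : ℕ → Ω → Mat N K) (y a : ℕ → Ω → Fin N → ℝ)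
    (T : ℕ) : ℝ :=
  ∑ t ∈ Finset.Icc 1 T, ∫ ω, (reward (x t ω) (a t ω) (r t ω) - ∑ n, a t ω n * y t ω n) ∂P

/-! ### Constants -/

/-- `Φ = ∑ φ_n`. -/
def bigPhi (φ : Fin N → ℝ) : ℝ := ∑ n, φ n

/-- `Θ = min (K + Φ) N`. -/
def bigTheta (K : ℕ) (φ : Fin N → ℝ) : ℝ := min (K + bigPhi φ) N

/-- `φ_min = min_n φ_n` (for `N ≥ 1`). -/
def phiMin (φ : Fin N → ℝ) : ℝ := ⨅ n, φ n

/-- `Ξ(δ)`. -/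
def bigXi (K : ℕ) (φ : Fin N → ℝ) (δ : ℝ) : ℝ :=
  3 * √N * bigTheta K φ ^ 2 / (phiMin φ - δ) * Real.log (2 * bigTheta K φ / (phiMin φ - δ))
    + 3 * √N * bigTheta K φ / (2 * δ)

/-- The step size `η`. -/
def stepSize (K : ℕ) (φ : Fin N → ℝ) (T : ℕ) : ℝ :=
  (4 * K + 2 * √(6 * K * T * bigPhi φ * Real.log T)) / (T * bigTheta K φ)

end IOL

end

/-!
Truthful agents never decline: the utility that the payment leaves to agent `n` is
`max L - max L_{-n}`, and this is nonnegative because an assignment without agent `n` is a competitor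
in the maximization of the Lagrangian `L` (`cost_le_payment`, `slotDecision_truthful`). So the
mechanism reduces to projected dual ascent on the multipliers, combined with upper confidence bounds
for the rewards.

*Fairness.* Comparing the assignment with the empty one shows that the squared norm of the
multipliers decreases as soon as their norm exceeds a constant over `φ_min`. This holds on every
sample path, so the multipliers, and with them the violation, are bounded deterministically
(`sqrt_sum_sq_lam_le`, `violation_path_le`); no stochastic drift argument is needed.

*Regret.* Comparing the assignment with a fair policy at the current costs splits the regret into
three parts (`policy_welfare_sub_le`). The penalty of the policy is nonpositive in expectation, since
the multipliers are independent of the current costs (`integral_lam_mul_policy_nonpos`). The penalty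
of the mechanism telescopes along the squared norm of the multipliers (`neg_sum_lam_mul_le`). What
remains are the estimation errors. Hoeffding's inequality holds for the adaptively sampled rewards
through an exponential supermartingale (`integral_exp_adaptive_le_one`,
`measureReal_deviation_le`), so that failures of the confidence bounds cost at most a constant per
arm, and the confidence radii over the pulls sum up to the square root of the number of pulls, which
is at most `T Φ` plus the violation (`sum_estimate_sub_mul_le`, `integral_gap_le`).

*Profit.* Each payment is at most the estimated reward of the assigned arm, so the loss of the
principal is bounded by the same estimation errors (`neg_integral_gap_le_profit`).
-/

namespace IOL

variable {N K : ℕ}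

/-! ### Assignments -/

theorem zero_mem_assignments : (0 : Mat N K) ∈ assignments N K := by
  refine ⟨fun _ _ => Or.inl rfl, fun _ => ?_, fun _ => ?_⟩ <;> simp

theorem assignments_finite : (assignments N K).Finite := by
  refine (Set.Finite.pi (t := fun _ : Fin N => Set.univ.pi fun _ : Fin K => ({0, 1} : Set ℝ))
    fun _ => Set.Finite.pi fun _ => Set.toFinite _).subset ?_
  intro x hx n _ k _
  exact hx.1 n k

theorem nonneg_of_mem_assignments {x : Mat N K} (hx : x ∈ assignments N K) (n : Fin N)
    (k : Fin K) : 0 ≤ x n k := by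
  rcases hx.1 n k with h | h <;> simp [h]

theorem le_one_of_mem_assignments {x : Mat N K} (hx : x ∈ assignments N K) (n : Fin N)
    (k : Fin K) : x n k ≤ 1 := by
  rcases hx.1 n k with h | h <;> simp [h]

theorem row_sum_nonneg {x : Mat N K} (hx : x ∈ assignments N K) (n : Fin N) : 0 ≤ ∑ k, x n k :=
  Finset.sum_nonneg fun k _ => nonneg_of_mem_assignments hx n k

theorem col_sum_nonneg {x : Mat N K} (hx : x ∈ assignments N K) (k : Fin K) : 0 ≤ ∑ n, x n k :=
  Finset.sum_nonneg fun n _ => nonneg_of_mem_assignments hx n k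

theorem col_sum_eq_zero_or_one {x : Mat N K} (hx : x ∈ assignments N K) (k : Fin K) :
    ∑ n, x n k = 0 ∨ ∑ n, x n k = 1 := by
  by_cases h : ∃ n, x n k = 1
  · obtain ⟨n, hn⟩ := h
    refine Or.inr (le_antisymm (hx.2.2 k) ?_)
    rw [← hn]
    exact Finset.single_le_sum (fun i _ => nonneg_of_mem_assignments hx i k) (Finset.mem_univ n)
  · push Not at h
    exact Or.inl (Finset.sum_eq_zero fun n _ => (hx.1 n k).resolve_right (h n))

theorem sum_entries_le_arms {x : Mat N K} (hx : x ∈ assignments N K) :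
    ∑ n, ∑ k, x n k ≤ K := by
  rw [Finset.sum_comm]
  exact (Finset.sum_le_sum fun k _ => hx.2.2 k).trans (by simp)

theorem sum_entries_le_agents {x : Mat N K} (hx : x ∈ assignments N K) :
    ∑ n, ∑ k, x n k ≤ N :=
  (Finset.sum_le_sum fun n _ => hx.2.1 n).trans (by simp)

theorem update_zero_mem_assignments {x : Mat N K} (hx : x ∈ assignments N K) (n : Fin N) :
    Function.update x n 0 ∈ assignments N K := by
  have hle : ∀ i k, Function.update x n 0 i k ≤ x i k := fun i k => by
    rcases eq_or_ne i n with rfl | h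
    · simpa using nonneg_of_mem_assignments hx i k
    · simp [h]
  refine ⟨fun i k => ?_, fun i => ?_, fun k => ?_⟩
  · rcases eq_or_ne i n with rfl | h
    · simp
    · simpa [h] using hx.1 i k
  · exact (Finset.sum_le_sum fun k _ => hle i k).trans (hx.2.1 i)
  · exact (Finset.sum_le_sum fun i _ => hle i k).trans (hx.2.2 k)

/-! ### Individual rationality of the payments -/

theorem utilization_one (x : Mat N K) (n : Fin N) : utilization x 1 n = ∑ k, x n k := by
  simp [utilization]

theorem lagrangian_eq_sum (φ lam : Fin N → ℝ) (rhat : Fin K → ℝ) (c x : Mat N K) :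
    lagrangian φ lam rhat c x
      = ∑ n, ∑ k, (rhat k - c n k - lam n) * x n k + ∑ n, lam n * φ n := by
  simp only [lagrangian, welfare, reward, cost, utilization_one, Pi.one_apply, mul_one]
  rw [Finset.sum_comm (s := (Finset.univ : Finset (Fin K)))]
  simp only [mul_sub, sub_mul, Finset.sum_sub_distrib, Finset.mul_sum]
  ring

theorem lagrangianWithout_eq_sum (φ lam : Fin N → ℝ) (rhat : Fin K → ℝ) (c : Mat N K) (n : Fin N)
    (x : Mat N K) :
    lagrangianWithout φ lam rhat c n x
      = ∑ i ∈ Finset.univ.erase n, ∑ k, (rhat k - c i k - lam i) * x i k + ∑ i, lam i * φ i := by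
  simp only [lagrangianWithout, utilization_one]
  rw [Finset.sum_comm (s := (Finset.univ : Finset (Fin K)))]
  simp only [sub_mul, Finset.sum_sub_distrib, Finset.mul_sum]

theorem lagrangian_eq_lagrangianWithout_add (φ lam : Fin N → ℝ) (rhat : Fin K → ℝ)
    (c x : Mat N K) (n : Fin N) :
    lagrangian φ lam rhat c x
      = lagrangianWithout φ lam rhat c n x + ∑ k, (rhat k - c n k - lam n) * x n k := by
  rw [lagrangian_eq_sum, lagrangianWithout_eq_sum,
    ← Finset.add_sum_erase _ _ (Finset.mem_univ n)]
  ring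

theorem lagrangianWithout_eq_lagrangian_update (φ lam : Fin N → ℝ) (rhat : Fin K → ℝ)
    (c x : Mat N K) (n : Fin N) :
    lagrangianWithout φ lam rhat c n x = lagrangian φ lam rhat c (Function.update x n 0) := by
  rw [lagrangian_eq_lagrangianWithout_add φ lam rhat c _ n, lagrangianWithout_eq_sum,
    lagrangianWithout_eq_sum]
  simp only [Function.update_self, Pi.zero_apply, mul_zero, Finset.sum_const_zero, add_zero]
  congr 1
  refine Finset.sum_congr rfl fun i hi => ?_
  rw [Function.update_of_ne (Finset.ne_of_mem_erase hi)]

/-- The payment covers the cost: a maximizer of the Lagrangian beats every assignment in which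
agent `n` is left out, so the utility of agent `n` is the nonnegative number
`max L - max L_{-n}`. -/
theorem cost_le_payment {φ lam : Fin N → ℝ} {rhat : Fin K → ℝ} {c x : Mat N K}
    (hx : IsMaxOn (lagrangian φ lam rhat c) (assignments N K) x) (n : Fin N) :
    ∑ k, c n k * x n k ≤ payment φ lam rhat c x n := by
  have hmax : maxLagrangianWithout φ lam rhat c n ≤ lagrangian φ lam rhat c x := by
    refine csSup_le ⟨_, _, zero_mem_assignments, rfl⟩ ?_
    rintro _ ⟨z, hz, rfl⟩
    rw [lagrangianWithout_eq_lagrangian_update]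
    exact hx (update_zero_mem_assignments hz n)
  rw [lagrangian_eq_lagrangianWithout_add φ lam rhat c x n] at hmax
  have : ∑ k, (rhat k - lam n) * x n k - ∑ k, c n k * x n k
      = ∑ k, (rhat k - c n k - lam n) * x n k := by
    rw [← Finset.sum_sub_distrib]
    exact Finset.sum_congr rfl fun k _ => by ring
  unfold payment
  linarith

theorem payment_le (φ lam : Fin N → ℝ) (rhat : Fin K → ℝ) (c : Mat N K) {x : Mat N K}
    (hx : x ∈ assignments N K) (n : Fin N) :
    payment φ lam rhat c x n ≤ ∑ k, (rhat k - lam n) * x n k := by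
  have : lagrangianWithout φ lam rhat c n x ≤ maxLagrangianWithout φ lam rhat c n :=
    le_csSup (assignments_finite.image _).bddAbove ⟨x, hx, rfl⟩
  unfold payment
  linarith

/-- Truthful agents always follow the proposal. -/
theorem slotDecision_truthful {φ : Fin N → ℝ} {sel : Rule N K} (hsel : IsMaximizingRule φ sel)
    (c : Mat N K) (t : ℕ) (s : State N K) : slotDecision φ sel c c t s = 1 := by
  funext n
  have h := cost_le_payment (hsel.isMax t s.lam (estimate t s) c) n
  refine if_pos ?_
  simp only [payoff, mul_zero, mul_one, sub_nonneg]
  exact h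

/-! ### The dynamics under truthful bids -/

section Dynamics

variable {φ : Fin N → ℝ} {η : ℝ} {sel : Rule N K} (c : ℕ → Mat N K) (r : ℕ → Fin K → ℝ)

theorem xHat_mem (hsel : IsMaximizingRule φ sel) (t : ℕ) :
    xHat φ η sel c c r t ∈ assignments N K :=
  hsel.mem _ _ _ _

theorem aHat_eq_one (hsel : IsMaximizingRule φ sel) (t : ℕ) : aHat φ η sel c c r t = 1 :=
  slotDecision_truthful hsel _ _ _

theorem lam_succ (t : ℕ) (n : Fin N) :
    (state φ η sel c c r (t + 1)).lam n
      = max ((state φ η sel c c r t).lam n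
          + η * (∑ k, xHat φ η sel c c r (t + 1) n k - φ n)) 0 := by
  simp only [state, update, utilization_one, xHat, Nat.add_sub_cancel]
  ring_nf

theorem count_succ (hsel : IsMaximizingRule φ sel) (t : ℕ) (k : Fin K) :
    (state φ η sel c c r (t + 1)).count k
      = (state φ η sel c c r t).count k + ∑ n, xHat φ η sel c c r (t + 1) n k := by
  simp [state, update, slotDecision_truthful hsel, xHat]

theorem avg_succ (hsel : IsMaximizingRule φ sel) (t : ℕ) (k : Fin K) :
    (state φ η sel c c r (t + 1)).avg k
      = ((state φ η sel c c r t).avg k * (state φ η sel c c r t).count k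
          + r (t + 1) k * ∑ n, xHat φ η sel c c r (t + 1) n k)
        / (state φ η sel c c r (t + 1)).count k := by
  rw [count_succ c r hsel]
  simp [state, update, slotDecision_truthful hsel, xHat]

theorem lam_nonneg (t : ℕ) (n : Fin N) : 0 ≤ (state φ η sel c c r t).lam n := by
  cases t with
  | zero => exact le_rfl
  | succ t => rw [lam_succ]; exact le_max_right _ _

theorem count_mem_nat (hsel : IsMaximizingRule φ sel) (t : ℕ) (k : Fin K) :
    ∃ h : ℕ, h ≤ t ∧ (state φ η sel c c r t).count k = h := by
  induction t with
  | zero => exact ⟨0, le_rfl, by simp [state]⟩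
  | succ t ih =>
    obtain ⟨h, hle, heq⟩ := ih
    rw [count_succ c r hsel, heq]
    rcases col_sum_eq_zero_or_one (xHat_mem c r hsel (t + 1) (η := η)) k with h0 | h1
    · exact ⟨h, by omega, by rw [h0, add_zero]⟩
    · exact ⟨h + 1, by omega, by rw [h1]; push_cast; rfl⟩

theorem count_nonneg (hsel : IsMaximizingRule φ sel) (t : ℕ) (k : Fin K) :
    0 ≤ (state φ η sel c c r t).count k := by
  obtain ⟨h, -, heq⟩ := count_mem_nat c r hsel t k (η := η)
  rw [heq]
  positivity

theorem count_eq_sum (hsel : IsMaximizingRule φ sel) (t : ℕ) (k : Fin K) :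
    (state φ η sel c c r t).count k
      = ∑ s ∈ Finset.range t, ∑ n, xHat φ η sel c c r (s + 1) n k := by
  induction t with
  | zero => simp [state]
  | succ t ih => rw [count_succ c r hsel, Finset.sum_range_succ, ih]

/-- The product form of the empirical average; it holds before the first pull as well, where both
sides vanish and the quotient that defines `avg` is `0 / 0 = 0`. -/
theorem avg_mul_count (hsel : IsMaximizingRule φ sel) (t : ℕ) (k : Fin K) :
    (state φ η sel c c r t).avg k * (state φ η sel c c r t).count k
      = ∑ s ∈ Finset.range t, r (s + 1) k * ∑ n, xHat φ η sel c c r (s + 1) n k := by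
  induction t with
  | zero => simp [state]
  | succ t ih =>
    rw [Finset.sum_range_succ, ← ih, avg_succ c r hsel]
    rcases eq_or_ne ((state φ η sel c c r (t + 1)).count k) 0 with h0 | h0
    · have h := h0
      rw [count_succ c r hsel] at h
      have h1 := count_nonneg c r hsel t k (η := η)
      have h2 := col_sum_nonneg (xHat_mem c r hsel (t + 1) (η := η)) k
      rw [h0, show (state φ η sel c c r t).count k = 0 by linarith,
        show ∑ n, xHat φ η sel c c r (t + 1) n k = 0 by linarith]
      simp
    · rw [div_mul_cancel₀ _ h0]

theorem avg_nonneg (hsel : IsMaximizingRule φ sel) (hr : ∀ t k, 0 ≤ r t k) (t : ℕ) (k : Fin K) :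
    0 ≤ (state φ η sel c c r t).avg k := by
  cases t with
  | zero => exact le_rfl
  | succ t =>
    rw [avg_succ c r hsel, avg_mul_count c r hsel]
    refine div_nonneg (add_nonneg (Finset.sum_nonneg fun s _ => mul_nonneg (hr _ _) ?_)
      (mul_nonneg (hr _ _) ?_)) (count_nonneg c r hsel _ _)
    · exact col_sum_nonneg (xHat_mem c r hsel (s + 1)) k
    · exact col_sum_nonneg (xHat_mem c r hsel (t + 1)) k

theorem estimate_le_one (t : ℕ) (s : State N K) (k : Fin K) : estimate t s k ≤ 1 := by
  unfold estimate
  split_ifs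
  · exact min_le_right _ _
  · exact le_rfl

theorem estimate_nonneg (t : ℕ) {s : State N K} (hs : ∀ k, 0 ≤ s.avg k) (k : Fin K) :
    0 ≤ estimate t s k := by
  unfold estimate
  split_ifs
  · exact le_min (add_nonneg (hs k) (Real.sqrt_nonneg _)) zero_le_one
  · exact zero_le_one

end Dynamics

/-! ### Drift of the multipliers -/

section Drift

variable {φ : Fin N → ℝ} {η : ℝ} {sel : Rule N K} (c : ℕ → Mat N K) (r : ℕ → Fin K → ℝ)

theorem bigPhi_nonneg (hφ : ∀ n, φ n ∈ Set.Icc (0 : ℝ) 1) : 0 ≤ bigPhi φ :=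
  Finset.sum_nonneg fun n _ => (hφ n).1

theorem one_le_bigTheta (hN : 1 ≤ N) (hK : 1 ≤ K) (hφ : ∀ n, φ n ∈ Set.Icc (0 : ℝ) 1) :
    1 ≤ bigTheta K φ := by
  have h1 : (1 : ℝ) ≤ N := by exact_mod_cast hN
  have h2 : (1 : ℝ) ≤ K := by exact_mod_cast hK
  exact le_min (by linarith [bigPhi_nonneg hφ]) h1

theorem sum_entries_le_bigTheta (hφ : ∀ n, φ n ∈ Set.Icc (0 : ℝ) 1) {x : Mat N K}
    (hx : x ∈ assignments N K) : ∑ n, ∑ k, x n k ≤ bigTheta K φ :=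
  le_min (by linarith [sum_entries_le_arms hx, bigPhi_nonneg hφ]) (sum_entries_le_agents hx)

theorem sum_sq_utilization_sub_le (hφ : ∀ n, φ n ∈ Set.Icc (0 : ℝ) 1) {x : Mat N K}
    (hx : x ∈ assignments N K) : ∑ n, (∑ k, x n k - φ n) ^ 2 ≤ bigTheta K φ := by
  refine le_min ?_ ?_
  · have h : ∀ n, (∑ k, x n k - φ n) ^ 2 ≤ ∑ k, x n k + φ n := fun n => by
      have h0 := row_sum_nonneg hx n
      nlinarith [hx.2.1 n, (hφ n).1, (hφ n).2, mul_nonneg h0 (hφ n).1]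
    refine (Finset.sum_le_sum fun n _ => h n).trans ?_
    rw [Finset.sum_add_distrib]
    exact add_le_add (sum_entries_le_arms hx) le_rfl
  · have h : ∀ n, (∑ k, x n k - φ n) ^ 2 ≤ 1 := fun n => by
      have h0 := row_sum_nonneg hx n
      nlinarith [hx.2.1 n, (hφ n).1, (hφ n).2]
    exact (Finset.sum_le_sum fun n _ => h n).trans (by simp)

theorem sum_sq_lam_succ_le (hsel : IsMaximizingRule φ sel) (hφ : ∀ n, φ n ∈ Set.Icc (0 : ℝ) 1)
    (t : ℕ) :
    ∑ n, (state φ η sel c c r (t + 1)).lam n ^ 2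
      ≤ ∑ n, (state φ η sel c c r t).lam n ^ 2
        + 2 * η * ∑ n, (state φ η sel c c r t).lam n
            * (∑ k, xHat φ η sel c c r (t + 1) n k - φ n)
        + η ^ 2 * bigTheta K φ := by
  have hmax : ∀ a : ℝ, max a 0 ^ 2 ≤ a ^ 2 := fun a => by
    rcases max_cases a 0 with ⟨h, -⟩ | ⟨h, -⟩ <;> rw [h]
    simpa using sq_nonneg a
  calc ∑ n, (state φ η sel c c r (t + 1)).lam n ^ 2
      ≤ ∑ n, ((state φ η sel c c r t).lam n
          + η * (∑ k, xHat φ η sel c c r (t + 1) n k - φ n)) ^ 2 :=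
        Finset.sum_le_sum fun n _ => by rw [lam_succ]; exact hmax _
    _ = ∑ n, (state φ η sel c c r t).lam n ^ 2
        + 2 * η * ∑ n, (state φ η sel c c r t).lam n
            * (∑ k, xHat φ η sel c c r (t + 1) n k - φ n)
        + η ^ 2 * ∑ n, (∑ k, xHat φ η sel c c r (t + 1) n k - φ n) ^ 2 := by
        rw [Finset.mul_sum, Finset.mul_sum, ← Finset.sum_add_distrib, ← Finset.sum_add_distrib]
        exact Finset.sum_congr rfl fun n _ => by ring
    _ ≤ _ := by
        gcongr
        exact sum_sq_utilization_sub_le hφ (xHat_mem c r hsel _)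

/-- The regret of the dual variables: telescoping of the squared norm of the multipliers. -/
theorem neg_sum_lam_mul_le (hsel : IsMaximizingRule φ sel)
    (hφ : ∀ n, φ n ∈ Set.Icc (0 : ℝ) 1) (hη : 0 < η) (T : ℕ) :
    -∑ t ∈ Finset.range T, ∑ n, (state φ η sel c c r t).lam n
        * (∑ k, xHat φ η sel c c r (t + 1) n k - φ n)
      ≤ η * T * bigTheta K φ / 2 := by
  have key : 2 * η * -∑ t ∈ Finset.range T, ∑ n, (state φ η sel c c r t).lam n
        * (∑ k, xHat φ η sel c c r (t + 1) n k - φ n)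
      ≤ η ^ 2 * T * bigTheta K φ - ∑ n, (state φ η sel c c r T).lam n ^ 2 := by
    induction T with
    | zero => simp [state]
    | succ T ih =>
      have h := sum_sq_lam_succ_le c r hsel hφ (η := η) T
      rw [Finset.sum_range_succ]
      push_cast
      linarith
  have hQ : 0 ≤ ∑ n, (state φ η sel c c r T).lam n ^ 2 := Finset.sum_nonneg fun _ _ => sq_nonneg _
  refine le_of_mul_le_mul_left (a := 2 * η) ?_ (by positivity)
  linarith

theorem phiMin_le (n : Fin N) : phiMin φ ≤ φ n := ciInf_le (Set.finite_range φ).bddBelow n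

/-- Comparison with the empty assignment: the multipliers are pushed down once they are large. -/
theorem sum_lam_mul_le (hsel : IsMaximizingRule φ sel) (hφ : ∀ n, φ n ∈ Set.Icc (0 : ℝ) 1)
    (hc : ∀ t n k, 0 ≤ c t n k) (hmin : 0 ≤ phiMin φ) (t : ℕ) :
    ∑ n, (state φ η sel c c r t).lam n * (∑ k, xHat φ η sel c c r (t + 1) n k - φ n)
      ≤ bigTheta K φ - phiMin φ * √(∑ n, (state φ η sel c c r t).lam n ^ 2) := by
  set s := state φ η sel c c r t with hs
  set x := xHat φ η sel c c r (t + 1) with hx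
  have hxm : x ∈ assignments N K := xHat_mem c r hsel _
  have hopt : lagrangian φ s.lam (estimate (t + 1) s) (c (t + 1)) 0
      ≤ lagrangian φ s.lam (estimate (t + 1) s) (c (t + 1)) x :=
    hsel.isMax (t + 1) s.lam (estimate (t + 1) s) (c (t + 1)) zero_mem_assignments
  rw [lagrangian_eq_sum, lagrangian_eq_sum] at hopt
  simp only [Pi.zero_apply, mul_zero, Finset.sum_const_zero, zero_add] at hopt
  have h1 : ∑ n, ∑ k, (estimate (t + 1) s k - c (t + 1) n k - s.lam n) * x n k
      ≤ ∑ n, ∑ k, x n k - ∑ n, s.lam n * ∑ k, x n k := by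
    rw [← Finset.sum_sub_distrib]
    refine Finset.sum_le_sum fun n _ => ?_
    rw [Finset.mul_sum, ← Finset.sum_sub_distrib]
    refine Finset.sum_le_sum fun k _ => ?_
    nlinarith [nonneg_of_mem_assignments hxm n k, estimate_le_one (t + 1) s k, hc (t + 1) n k]
  have h2 : √(∑ n, s.lam n ^ 2) ≤ ∑ n, s.lam n := by
    have h0 : ∀ n, 0 ≤ s.lam n := lam_nonneg c r t
    refine Real.sqrt_le_iff.2 ⟨Finset.sum_nonneg fun n _ => h0 n, ?_⟩
    exact Finset.sum_sq_le_sq_sum_of_nonneg (fun n _ => h0 n)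
  have h3 : phiMin φ * ∑ n, s.lam n ≤ ∑ n, s.lam n * φ n := by
    rw [Finset.mul_sum]
    refine Finset.sum_le_sum fun n _ => ?_
    rw [mul_comm]
    exact mul_le_mul_of_nonneg_left (phiMin_le n) (lam_nonneg c r t n)
  have h4 := mul_le_mul_of_nonneg_left h2 hmin
  have h5 := sum_entries_le_bigTheta hφ hxm
  simp only [mul_sub, Finset.sum_sub_distrib]
  linarith

/-- The multipliers stay bounded on every sample path: the empty assignment is a Slater point. -/
theorem sqrt_sum_sq_lam_le (hsel : IsMaximizingRule φ sel) (hφ : ∀ n, φ n ∈ Set.Icc (0 : ℝ) 1)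
    (hc : ∀ t n k, 0 ≤ c t n k) (hmin : 0 < phiMin φ) (hη : 0 < η) (hΘ : 0 ≤ bigTheta K φ)
    (t : ℕ) :
    √(∑ n, (state φ η sel c c r t).lam n ^ 2)
      ≤ (bigTheta K φ + η * bigTheta K φ / 2) / phiMin φ + η * √(bigTheta K φ) := by
  set Θ := bigTheta K φ
  induction t with
  | zero =>
    simp only [state, Pi.zero_apply]
    simp only [ne_eq, OfNat.ofNat_ne_zero, not_false_eq_true, zero_pow, Finset.sum_const_zero,
      Real.sqrt_zero]
    positivity
  | succ t ih =>
    have hd := sum_sq_lam_succ_le c r hsel hφ (η := η) t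
    have hl := sum_lam_mul_le c r hsel hφ hc hmin.le (η := η) t
    have hcs : ∑ n, (state φ η sel c c r t).lam n
        * (∑ k, xHat φ η sel c c r (t + 1) n k - φ n)
        ≤ √(∑ n, (state φ η sel c c r t).lam n ^ 2) * √Θ :=
      (Real.sum_mul_le_sqrt_mul_sqrt _ _ _).trans (mul_le_mul_of_nonneg_left
        (Real.sqrt_le_sqrt (sum_sq_utilization_sub_le hφ (xHat_mem c r hsel _)))
        (Real.sqrt_nonneg _))
    set Q := ∑ n, (state φ η sel c c r t).lam n ^ 2
    have hQ : 0 ≤ Q := Finset.sum_nonneg fun _ _ => sq_nonneg _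
    have hsq := Real.sq_sqrt hQ
    have hsΘ := Real.sq_sqrt hΘ
    rcases le_total (√Q) ((Θ + η * Θ / 2) / phiMin φ) with h | h
    · refine (Real.sqrt_le_iff.2 ⟨by positivity, ?_⟩).trans
        (add_le_add h (le_refl (η * √Θ)))
      nlinarith
    · refine (Real.sqrt_le_sqrt (y := Q) ?_).trans ih
      rw [div_le_iff₀ hmin] at h
      nlinarith

theorem sum_le_lam (T : ℕ) (n : Fin N) :
    η * ∑ t ∈ Finset.range T, (∑ k, xHat φ η sel c c r (t + 1) n k - φ n)
      ≤ (state φ η sel c c r T).lam n := by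
  induction T with
  | zero => simp [state]
  | succ T ih =>
    rw [Finset.sum_range_succ, lam_succ, mul_add]
    exact (add_le_add ih le_rfl).trans (le_max_left _ _)

theorem violation_path_le_lam (hη : 0 < η) (T : ℕ) :
    ∑ n, max (∑ t ∈ Finset.range T, (∑ k, xHat φ η sel c c r (t + 1) n k - φ n)) 0
      ≤ √N * √(∑ n, (state φ η sel c c r T).lam n ^ 2) / η := by
  rw [le_div_iff₀ hη, Finset.sum_mul]
  calc _ ≤ ∑ n, 1 * (state φ η sel c c r T).lam n := by
        refine Finset.sum_le_sum fun n _ => ?_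
        rw [one_mul, max_mul_of_nonneg _ _ hη.le, zero_mul, mul_comm]
        exact max_le (sum_le_lam c r T n) (lam_nonneg c r T n)
    _ ≤ _ := by
        refine (Real.sum_mul_le_sqrt_mul_sqrt _ _ _).trans_eq ?_
        simp

theorem stepSize_pos {T : ℕ} (hN : 1 ≤ N) (hK : 1 ≤ K) (hT : 1 ≤ T)
    (hφ : ∀ n, φ n ∈ Set.Icc (0 : ℝ) 1) : 0 < stepSize K φ T := by
  have h1 := one_le_bigTheta hN hK hφ
  have h2 : (0 : ℝ) < K := by exact_mod_cast hK
  have h3 : (0 : ℝ) < T := by exact_mod_cast hT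
  unfold stepSize
  positivity

/-- The fairness violation on every sample path, from the boundedness of the multipliers. The first
summand of `Ξ` is not needed. In a single slot the violation is at most `Θ`. -/
theorem violation_path_le {T : ℕ} (hN : 1 ≤ N) (hK : 1 ≤ K) (hT : 1 ≤ T)
    (hsel : IsMaximizingRule φ sel) (hφ : ∀ n, φ n ∈ Set.Icc (0 : ℝ) 1)
    (hc : ∀ t n k, 0 ≤ c t n k) {δ : ℝ} (hδ : δ ∈ Set.Ioo 0 (phiMin φ))
    (hη : η = stepSize K φ T) :
    ∑ n, max (∑ t ∈ Finset.range T, (∑ k, xHat φ η sel c c r (t + 1) n k - φ n)) 0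
      ≤ bigXi K φ δ + bigTheta K φ ^ 2 / (4 * δ) * √(N * T / (K * bigPhi φ)) := by
  have hηpos : 0 < η := hη ▸ stepSize_pos hN hK hT hφ
  have hΘ := one_le_bigTheta hN hK hφ
  have hn : phiMin φ ≤ φ ⟨0, hN⟩ := phiMin_le _
  have hmin1 : phiMin φ ≤ 1 := hn.trans (hφ _).2
  have hΦ : 0 < bigPhi φ := by
    have : φ ⟨0, hN⟩ ≤ bigPhi φ :=
      Finset.single_le_sum (f := φ) (fun n _ => (hφ n).1) (Finset.mem_univ _)
    linarith [hδ.1, hδ.2]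
  obtain ⟨hδ0, hδ1⟩ := hδ
  have hN1 : 1 ≤ √(N : ℝ) := Real.one_le_sqrt.2 (by exact_mod_cast hN)
  have hK1 : (1 : ℝ) ≤ K := by exact_mod_cast hK
  have hT1 : (1 : ℝ) ≤ T := by exact_mod_cast hT
  have hlog : 0 ≤ Real.log (2 * bigTheta K φ / (phiMin φ - δ)) := by
    refine Real.log_nonneg ?_
    rw [le_div_iff₀ (by linarith)]
    linarith
  have hXi : 3 * √N * bigTheta K φ / (2 * δ) ≤ bigXi K φ δ := by
    have : 0 < phiMin φ - δ := by linarith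
    unfold bigXi
    exact le_add_of_nonneg_left (by positivity)
  rcases hT.eq_or_lt with rfl | hT2
  · have h1 : ∑ n, max (∑ t ∈ Finset.range 1, (∑ k, xHat φ η sel c c r (t + 1) n k - φ n)) 0
        ≤ ∑ n, ∑ k, xHat φ η sel c c r 1 n k := by
      refine Finset.sum_le_sum fun n _ => ?_
      simp only [Finset.range_one, Finset.sum_singleton, zero_add]
      exact max_le (by linarith [(hφ n).1]) (row_sum_nonneg (xHat_mem c r hsel 1) n)
    have h2 := sum_entries_le_bigTheta hφ (xHat_mem c r hsel 1 (η := η))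
    have h3 : bigTheta K φ ≤ 3 * √N * bigTheta K φ / (2 * δ) := by
      rw [le_div_iff₀ (by positivity)]
      nlinarith
    have h4 : 0 ≤ bigTheta K φ ^ 2 / (4 * δ) * √(N * (1 : ℕ) / (K * bigPhi φ)) := by positivity
    linarith
  · have hQ := sqrt_sum_sq_lam_le c r hsel hφ hc (by linarith) hηpos (by linarith) T
    have hv := violation_path_le_lam c r hηpos T (φ := φ) (sel := sel)
    set Θ := bigTheta K φ
    set Φ := bigPhi φ
    have hT2' : (2 : ℝ) ≤ T := by exact_mod_cast hT2
    have hlogT : 2 / 3 ≤ Real.log T := by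
      have := Real.log_two_gt_d9
      have := Real.log_le_log (by norm_num) hT2'
      linarith
    -- `6 ln T ≥ 4` for `T ≥ 2`, so `1 / η` is at most `Θ √T / (4 √(K Φ))`
    have hinv : 1 / η ≤ Θ / 4 * √(T / (K * Φ)) := by
      have hs : √(T / (K * Φ)) = T / √(K * T * Φ) := by
        rw [show (T : ℝ) / (K * Φ) = T ^ 2 / (K * T * Φ) by field_simp, Real.sqrt_div (by positivity),
          Real.sqrt_sq (by positivity)]
      have hge : 2 * √(K * T * Φ) ≤ √(6 * K * T * Φ * Real.log T) := by
        rw [show (2 : ℝ) = √4 by rw [show (4 : ℝ) = 2 ^ 2 by norm_num]; simp,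
          ← Real.sqrt_mul (by norm_num)]
        refine Real.sqrt_le_sqrt ?_
        have : 0 < (K : ℝ) * T * Φ := by positivity
        nlinarith
      have hpos : 0 < √(K * T * Φ) := Real.sqrt_pos.2 (by positivity)
      rw [hs, hη, stepSize, one_div_div, div_mul_div_comm, mul_comm Θ]
      exact div_le_div_of_nonneg_left (by positivity) (by positivity) (by linarith)
    have hmain : √(∑ n, (state φ η sel c c r T).lam n ^ 2) / η
        ≤ 3 * Θ / (2 * δ) + Θ ^ 2 / (4 * δ) * √(T / (K * Φ)) := by
      have hΘsq : √Θ ≤ Θ := Real.sqrt_le_iff.2 ⟨by linarith, by nlinarith⟩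
      have hA : (Θ + η * Θ / 2) / phiMin φ ≤ (Θ + η * Θ / 2) / δ :=
        div_le_div_of_nonneg_left (by positivity) hδ0 hδ1.le
      have hB : η * √Θ ≤ η * Θ / δ := by
        rw [le_div_iff₀ hδ0]
        have : √Θ * δ ≤ Θ * 1 := mul_le_mul hΘsq (by linarith) hδ0.le (by linarith)
        nlinarith
      calc _ ≤ ((Θ + η * Θ / 2) / δ + η * Θ / δ) / η := by gcongr; linarith
        _ = 3 * Θ / (2 * δ) + Θ / δ * (1 / η) := by field_simp; ring
        _ ≤ 3 * Θ / (2 * δ) + Θ / δ * (Θ / 4 * √(T / (K * Φ))) := by gcongr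
        _ = _ := by ring
    calc _ ≤ √N * (√(∑ n, (state φ η sel c c r T).lam n ^ 2) / η) := by
          rw [← mul_div_assoc]; exact hv
      _ ≤ √N * (3 * Θ / (2 * δ) + Θ ^ 2 / (4 * δ) * √(T / (K * Φ))) := by gcongr
      _ = 3 * √N * Θ / (2 * δ) + Θ ^ 2 / (4 * δ) * √(N * T / (K * Φ)) := by
          rw [mul_div_assoc (N : ℝ), Real.sqrt_mul (by positivity)]
          ring
      _ ≤ _ := by gcongr

end Drift

/-! ### Optimism on a sample path -/

section Optimism

variable {φ : Fin N → ℝ} {η : ℝ} {sel : Rule N K} (c : ℕ → Mat N K) (r : ℕ → Fin K → ℝ)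

/-- After at least one observation, the empirical average of arm `k` exceeds `μ` by more than the
confidence radius of slot `t`. -/
def Overestimated (t : ℕ) (s : State N K) (k : Fin K) (μ : ℝ) : Prop :=
  0 < s.count k ∧ μ + √(3 * Real.log t / (2 * s.count k)) < s.avg k

/-- After at least one observation, the empirical average of arm `k` is below `μ` by more than the
confidence radius of slot `t`. -/
def Underestimated (t : ℕ) (s : State N K) (k : Fin K) (μ : ℝ) : Prop :=
  0 < s.count k ∧ s.avg k + √(3 * Real.log t / (2 * s.count k)) < μ

theorem le_estimate {t : ℕ} {s : State N K} {k : Fin K} {μ : ℝ} (hμ : μ ≤ 1)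
    (h : ¬ Underestimated t s k μ) : μ ≤ estimate t s k := by
  unfold estimate
  split_ifs with h0
  · exact le_min (not_lt.1 fun hlt => h ⟨h0, hlt⟩) hμ
  · exact hμ

open Classical in
/-- The estimates exceed the means, over the pulls of arm `k`, by at most the first pull, the slots
of overestimation, and the sum of twice the confidence radii, which telescopes. -/
theorem sum_estimate_sub_mul_le (hsel : IsMaximizingRule φ sel) (k : Fin K) {μ : ℝ}
    (hμ : 0 ≤ μ) (T : ℕ) :
    ∑ t ∈ Finset.range T, (estimate (t + 1) (state φ η sel c c r t) k - μ)
        * ∑ n, xHat φ η sel c c r (t + 1) n k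
      ≤ 1 + ∑ t ∈ Finset.range T,
          (if Overestimated (t + 1) (state φ η sel c c r t) k μ then (1 : ℝ) else 0)
        + 2 * √(6 * Real.log T) * √((state φ η sel c c r T).count k) := by
  -- the first pull contributes to the minimum only, as `√(h - 1)` is `0` for `h = 0` and `h = 1`
  have key : ∀ L : ℝ, ∀ S ≤ T, (∀ t < S, √(6 * Real.log (t + 1 : ℕ)) ≤ L) →
      ∑ t ∈ Finset.range S, (estimate (t + 1) (state φ η sel c c r t) k - μ)
        * ∑ n, xHat φ η sel c c r (t + 1) n k
      ≤ min ((state φ η sel c c r S).count k) 1 + ∑ t ∈ Finset.range S,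
          (if Overestimated (t + 1) (state φ η sel c c r t) k μ then (1 : ℝ) else 0)
        + 2 * L * √((state φ η sel c c r S).count k - 1) := by
    intro L S hS hL
    induction S with
    | zero => simp [state, Real.sqrt_eq_zero_of_nonpos]
    | succ S ih =>
      have ih := ih (by omega) fun t ht => hL t (by omega)
      have hLS := hL S (by omega)
      obtain ⟨h, -, hh⟩ := count_mem_nat c r hsel S k (η := η)
      rw [Finset.sum_range_succ, Finset.sum_range_succ, count_succ c r hsel]
      have hind : 0 ≤ (if Overestimated (S + 1) (state φ η sel c c r S) k μ
          then (1 : ℝ) else 0) := by split_ifs <;> norm_num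
      have he := estimate_le_one (S + 1) (state φ η sel c c r S) k
      rcases col_sum_eq_zero_or_one (xHat_mem c r hsel (S + 1) (η := η)) k with h0 | h1
      · rw [h0, mul_zero, add_zero, add_zero]
        linarith
      · rw [h1, mul_one]
        rw [hh] at ih ⊢
        rcases Nat.eq_zero_or_pos h with rfl | hpos
        · simp only [Nat.cast_zero, zero_add, min_self, sub_self, Real.sqrt_zero, mul_zero,
            add_zero, zero_sub] at ih ⊢
          rw [min_eq_left zero_le_one, Real.sqrt_eq_zero_of_nonpos (by norm_num)] at ih
          linarith
        · have h1' : (1 : ℝ) ≤ h := by exact_mod_cast hpos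
          rw [min_eq_right h1'] at ih
          rw [min_eq_right (by linarith), add_sub_cancel_right]
          have hL0 : 0 ≤ L := (Real.sqrt_nonneg _).trans hLS
          have ha := Real.sq_sqrt (show (0 : ℝ) ≤ h by linarith)
          have hb := Real.sq_sqrt (show (0 : ℝ) ≤ h - 1 by linarith)
          have hab : √((h : ℝ) - 1) ≤ √h := Real.sqrt_le_sqrt (by linarith)
          have hb0 := Real.sqrt_nonneg ((h : ℝ) - 1)
          have ha0 : 0 < √(h : ℝ) := Real.sqrt_pos.2 (by linarith)
          by_cases hover : Overestimated (S + 1) (state φ η sel c c r S) k μ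
          · rw [if_pos hover]
            nlinarith
          · rw [if_neg hover]
            have hcount : 0 < (state φ η sel c c r S).count k := by rw [hh]; linarith
            have h2 : (state φ η sel c c r S).avg k
                ≤ μ + √(3 * Real.log (S + 1 : ℕ) / (2 * h)) := by
              rw [← hh]
              exact not_lt.1 fun hlt => hover ⟨hcount, hlt⟩
            have h3 : estimate (S + 1) (state φ η sel c c r S) k
                ≤ μ + 2 * √(3 * Real.log (S + 1 : ℕ) / (2 * h)) := by
              unfold estimate
              rw [if_pos hcount, hh]
              exact (min_le_left _ _).trans (by linarith)
            have h4 : 2 * √(3 * Real.log (S + 1 : ℕ) / (2 * h))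
                = √(6 * Real.log (S + 1 : ℕ)) / √h := by
              rw [← Real.sqrt_div' _ (by linarith)]
              nth_rw 1 [show (2 : ℝ) = √(2 ^ 2) by simp]
              rw [← Real.sqrt_mul (by norm_num)]
              congr 1
              field_simp
              ring
            -- `1 / √h ≤ 2 (√h - √(h - 1))`
            have h5 : L / √h ≤ 2 * L * √h - 2 * L * √((h : ℝ) - 1) := by
              rw [div_le_iff₀ ha0]
              nlinarith [mul_nonneg hL0 (sq_nonneg (√(h : ℝ) - √((h : ℝ) - 1)))]
            have h6 : √(6 * Real.log (S + 1 : ℕ)) / √h ≤ L / √h := by gcongr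
            linarith
  refine (key (√(6 * Real.log T)) T le_rfl fun t ht => Real.sqrt_le_sqrt ?_).trans ?_
  · have : ((t + 1 : ℕ) : ℝ) ≤ T := by exact_mod_cast ht
    gcongr
  · gcongr
    · exact min_le_right _ _
    · linarith

end Optimism

/-! ### Independence of a slot from the past -/

section Independence

variable {Ω α β γ : Type*} [MeasurableSpace α] [MeasurableSpace β]

/-- The information available before slot `t` about the sequence `f`, together with the whole of
`g`. -/
abbrev history (f : ℕ → Ω → α) (g : Ω → β) (t : ℕ) : MeasurableSpace Ω :=
  MeasurableSpace.comap (fun ω => ((fun s : Finset.range t => f s ω), g ω)) inferInstance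

theorem measurable_history_left (f : ℕ → Ω → α) (g : Ω → β) {s t : ℕ} (hst : s < t) :
    Measurable[history f g t] (f s) :=
  ((measurable_pi_apply (⟨s, Finset.mem_range.2 hst⟩ : Finset.range t)).comp
    measurable_fst).comp
    (comap_measurable fun ω => ((fun s : Finset.range t => f s ω), g ω))

theorem measurable_history_right (f : ℕ → Ω → α) (g : Ω → β) (t : ℕ) :
    Measurable[history f g t] g :=
  measurable_snd.comp (comap_measurable _)

variable [MeasurableSpace Ω] [MeasurableSpace γ] {P : Measure Ω} [IsProbabilityMeasure P]

theorem history_le {f : ℕ → Ω → α} {g : Ω → β} (hf : ∀ t, Measurable (f t)) (hg : Measurable g)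
    (t : ℕ) : history f g t ≤ ‹MeasurableSpace Ω› :=
  ((measurable_pi_lambda _ fun s : Finset.range t => hf s).prodMk hg).comap_le

theorem indepFun_prodMk_of_prodMk {A : Ω → α} {B : Ω → β} {C : Ω → γ} (hA : Measurable A)
    (hB : Measurable B) (hC : Measurable C) (hAB : IndepFun A B P)
    (hABC : IndepFun (fun ω => (A ω, B ω)) C P) : IndepFun A (fun ω => (B ω, C ω)) P := by
  have := Measure.isProbabilityMeasure_map (μ := P) hA.aemeasurable
  have := Measure.isProbabilityMeasure_map (μ := P) hB.aemeasurable
  have := Measure.isProbabilityMeasure_map (μ := P) hC.aemeasurable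
  have hBC : IndepFun B C P := hABC.comp measurable_snd measurable_id
  rw [indepFun_iff_map_prod_eq_prod_map_map hA.aemeasurable (hB.prodMk hC).aemeasurable,
    hBC.map_prod_eq_prod_map_map hB.aemeasurable hC.aemeasurable, ← Measure.prodAssoc_prod,
    ← hAB.map_prod_eq_prod_map_map hA.aemeasurable hB.aemeasurable,
    ← hABC.map_prod_eq_prod_map_map (hA.prodMk hB).aemeasurable hC.aemeasurable,
    Measure.map_map MeasurableEquiv.prodAssoc.measurable ((hA.prodMk hB).prodMk hC)]
  rfl

theorem indep_history {f : ℕ → Ω → α} {g : Ω → β} (hf : ∀ t, Measurable (f t))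
    (hg : Measurable g) (hfi : iIndepFun f P) (hfg : IndepFun (fun ω t => f t ω) g P) (t : ℕ) :
    Indep (MeasurableSpace.comap (f t) inferInstance) (history f g t) P := by
  have hpast : IndepFun (f t) (fun ω (s : Finset.range t) => f s ω) P :=
    (hfi.indepFun_finset {t} (Finset.range t) (by simp) hf).comp
      (measurable_pi_apply (⟨t, Finset.mem_singleton_self t⟩ : ({t} : Finset ℕ))) measurable_id
  have hcomp : Measurable fun h : ℕ → α => (h t, fun s : Finset.range t => h s) :=
    (measurable_pi_apply t).prodMk (measurable_pi_lambda _ fun s => measurable_pi_apply _)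
  exact indepFun_prodMk_of_prodMk (hf t) (measurable_pi_lambda _ fun s => hf s) hg hpast
    (hfg.comp hcomp measurable_id)

theorem indepFun_of_measurable_history {f : ℕ → Ω → α} {g : Ω → β} (hf : ∀ t, Measurable (f t))
    (hg : Measurable g) (hfi : iIndepFun f P) (hfg : IndepFun (fun ω t => f t ω) g P) {t : ℕ}
    {h : Ω → γ} (hh : Measurable[history f g t] h) : IndepFun (f t) h P :=
  indep_of_indep_of_le_right (indep_history hf hg hfi hfg t) hh.comap_le

end Independence

/-! ### Measurability of the mechanism -/

section Measurability

variable {φ : Fin N → ℝ} {η : ℝ} {sel : Rule N K}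

theorem measurable_estimate {Ω : Type*} [MeasurableSpace Ω] {s : Ω → State N K} (t : ℕ)
    (hcount : Measurable fun ω => (s ω).count) (havg : Measurable fun ω => (s ω).avg) :
    Measurable fun ω => estimate t (s ω) := by
  refine measurable_pi_lambda _ fun k => ?_
  have h1 : Measurable fun ω => (s ω).count k := (measurable_pi_apply k).comp hcount
  have h2 : Measurable fun ω => (s ω).avg k := (measurable_pi_apply k).comp havg
  unfold estimate
  refine Measurable.ite (measurableSet_lt measurable_const h1) ?_ measurable_const
  fun_prop

/-- The state at the end of slot `t` is a measurable function of the costs and rewards of the slots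
up to `t`, for any σ-algebra that makes these measurable. -/
theorem measurable_state {Ω : Type*} [MeasurableSpace Ω] (hsel : IsMaximizingRule φ sel)
    {c : ℕ → Ω → Mat N K} {r : ℕ → Ω → Fin K → ℝ} (t : ℕ) (hc : ∀ s ≤ t, Measurable (c s))
    (hr : ∀ s ≤ t, Measurable (r s)) :
    Measurable (fun ω => (state φ η sel (fun s => c s ω) (fun s => c s ω) (fun s => r s ω) t).lam) ∧
    Measurable
      (fun ω => (state φ η sel (fun s => c s ω) (fun s => c s ω) (fun s => r s ω) t).count) ∧
    Measurable
      (fun ω => (state φ η sel (fun s => c s ω) (fun s => c s ω) (fun s => r s ω) t).avg) := by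
  induction t with
  | zero => exact ⟨measurable_const, measurable_const, measurable_const⟩
  | succ t ih =>
    obtain ⟨hl, hn, ha⟩ := ih (fun s hs => hc s (by omega)) (fun s hs => hr s (by omega))
    have hx : Measurable fun ω =>
        xHat φ η sel (fun s => c s ω) (fun s => c s ω) (fun s => r s ω) (t + 1) :=
      (hsel.measurable (t + 1)).comp
        (hl.prodMk ((measurable_estimate (t + 1) hn ha).prodMk (hc (t + 1) le_rfl)))
    have hxnk : ∀ n k, Measurable fun ω =>
        xHat φ η sel (fun s => c s ω) (fun s => c s ω) (fun s => r s ω) (t + 1) n k := fun n k =>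
      (measurable_pi_apply k).comp ((measurable_pi_apply n).comp hx)
    have hn' : ∀ k, Measurable fun ω =>
        (state φ η sel (fun s => c s ω) (fun s => c s ω) (fun s => r s ω) (t + 1)).count k := by
      intro k
      simp only [count_succ _ _ hsel]
      exact ((measurable_pi_apply k).comp hn).add (Finset.measurable_sum _ fun n _ => hxnk n k)
    refine ⟨measurable_pi_lambda _ fun n => ?_, measurable_pi_lambda _ hn',
      measurable_pi_lambda _ fun k => ?_⟩
    · simp only [lam_succ]
      exact ((((measurable_pi_apply n).comp hl).add
        (((Finset.measurable_sum _ fun k _ => hxnk n k).sub_const _).const_mul _))).max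
        measurable_const
    · simp only [avg_succ _ _ hsel]
      refine Measurable.div ?_ (hn' k)
      exact (((measurable_pi_apply k).comp ha).mul ((measurable_pi_apply k).comp hn)).add
        (((measurable_pi_apply k).comp (hr (t + 1) le_rfl)).mul
          (Finset.measurable_sum _ fun n _ => hxnk n k))

/-- The assignment in slot `t + 1` depends on the costs up to slot `t + 1` and on the rewards up to
slot `t`. -/
theorem measurable_xHat_succ {Ω : Type*} [MeasurableSpace Ω] (hsel : IsMaximizingRule φ sel)
    {c : ℕ → Ω → Mat N K} {r : ℕ → Ω → Fin K → ℝ} (t : ℕ) (hc : ∀ s ≤ t + 1, Measurable (c s))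
    (hr : ∀ s ≤ t, Measurable (r s)) :
    Measurable fun ω =>
      xHat φ η sel (fun s => c s ω) (fun s => c s ω) (fun s => r s ω) (t + 1) := by
  obtain ⟨hl, hn, ha⟩ := measurable_state hsel (η := η) t (fun s hs => hc s (by omega)) hr
  exact (hsel.measurable (t + 1)).comp
    (hl.prodMk ((measurable_estimate (t + 1) hn ha).prodMk (hc (t + 1) le_rfl)))

theorem measurable_payment {Ω : Type*} [MeasurableSpace Ω] {lam : Ω → Fin N → ℝ}
    {rhat : Ω → Fin K → ℝ} {c x : Ω → Mat N K} (hlam : Measurable lam) (hrhat : Measurable rhat)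
    (hc : Measurable c) (hx : Measurable x) (n : Fin N) :
    Measurable fun ω => payment φ (lam ω) (rhat ω) (c ω) (x ω) n := by
  have hl : ∀ n, Measurable fun ω => lam ω n := fun n => (measurable_pi_apply n).comp hlam
  have hr : ∀ k, Measurable fun ω => rhat ω k := fun k => (measurable_pi_apply k).comp hrhat
  have hc' : ∀ n k, Measurable fun ω => c ω n k := fun n k =>
    (measurable_pi_apply k).comp ((measurable_pi_apply n).comp hc)
  have hLag : ∀ z : Ω → Mat N K, Measurable z →
      Measurable fun ω => lagrangianWithout φ (lam ω) (rhat ω) (c ω) n (z ω) := by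
    intro z hz
    have hz' : ∀ n k, Measurable fun ω => z ω n k := fun n k =>
      (measurable_pi_apply k).comp ((measurable_pi_apply n).comp hz)
    simp only [lagrangianWithout_eq_sum]
    fun_prop
  have hmax : Measurable fun ω => maxLagrangianWithout φ (lam ω) (rhat ω) (c ω) n := by
    have : Countable (assignments N K) := assignments_finite.countable.to_subtype
    simp only [maxLagrangianWithout, sSup_image']
    exact Measurable.iSup fun z => hLag (fun _ => z) measurable_const
  have hx' : ∀ n k, Measurable fun ω => x ω n k := fun n k =>
    (measurable_pi_apply k).comp ((measurable_pi_apply n).comp hx)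
  unfold payment
  have := hLag x hx
  fun_prop

end Measurability

/-! ### Hoeffding's inequality for adaptively sampled rewards -/

section Hoeffding

variable {Ω : Type*} [mΩ : MeasurableSpace Ω] {P : Measure Ω} [IsProbabilityMeasure P]

/-- The exponential supermartingale behind Hoeffding's inequality. The indicator `p i` decides
whether the sample `ξ i` is taken; it may depend on the earlier samples, but not on `ξ i`. -/
theorem integral_exp_adaptive_le_one {ξ p : ℕ → Ω → ℝ} {F : ℕ → MeasurableSpace Ω} {μ : ℝ} {t : ℕ}
    (hF : ∀ i, F i ≤ mΩ) (hξ : ∀ i, Measurable (ξ i)) (hξ01 : ∀ i ω, ξ i ω ∈ Set.Icc (0 : ℝ) 1)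
    (hmean : ∀ i < t, ∫ ω, ξ i ω ∂P = μ) (hp : ∀ i ω, p i ω = 0 ∨ p i ω = 1)
    (hind : ∀ i, Indep (MeasurableSpace.comap (ξ i) inferInstance) (F i) P)
    (hpF : ∀ i, ∀ j ≤ i, Measurable[F i] (p j)) (hξF : ∀ i, ∀ j < i, Measurable[F i] (ξ j))
    (θ : ℝ) :
    Integrable (fun ω => Real.exp (θ * ∑ i ∈ Finset.range t, p i ω * (ξ i ω - μ)
        - θ ^ 2 / 8 * ∑ i ∈ Finset.range t, p i ω)) P ∧
      ∫ ω, Real.exp (θ * ∑ i ∈ Finset.range t, p i ω * (ξ i ω - μ)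
        - θ ^ 2 / 8 * ∑ i ∈ Finset.range t, p i ω) ∂P ≤ 1 := by
  induction t with
  | zero => simp
  | succ t ih =>
    obtain ⟨hint, hle⟩ := ih fun i hi => hmean i (by omega)
    set M : Ω → ℝ := fun ω => Real.exp (θ * ∑ i ∈ Finset.range t, p i ω * (ξ i ω - μ)
        - θ ^ 2 / 8 * ∑ i ∈ Finset.range t, p i ω) with hM
    set Y : Ω → ℝ := fun ω => Real.exp (θ * (ξ t ω - μ) - θ ^ 2 / 8) with hY
    have hMF : Measurable[F t] M := by
      have h1 : ∀ i ∈ Finset.range t, Measurable[F t] (p i) := fun i hi =>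
        hpF t i (Finset.mem_range.1 hi).le
      have h2 : ∀ i ∈ Finset.range t, Measurable[F t] (ξ i) := fun i hi =>
        hξF t i (Finset.mem_range.1 hi)
      refine Real.measurable_exp.comp (Measurable.sub ?_ ?_)
      · exact (Finset.measurable_fun_sum _ fun i hi =>
          (h1 i hi).mul ((h2 i hi).sub_const _)).const_mul _
      · exact (Finset.measurable_fun_sum _ fun i hi => h1 i hi).const_mul _
    have hpm : Measurable (p t) := (hpF t t le_rfl).mono (hF t) le_rfl
    have hpb : ∀ ω, ‖p t ω‖ ≤ 1 := fun ω => by rcases hp t ω with h | h <;> simp [h]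
    have hMp : Integrable (fun ω => M ω * p t ω) P :=
      hint.mul_bdd (c := 1) hpm.aestronglyMeasurable (ae_of_all _ hpb)
    have hsub : HasSubgaussianMGF (fun ω => ξ t ω - μ) ((‖(1 : ℝ) - 0‖₊ / 2) ^ 2) P := by
      have := hasSubgaussianMGF_of_mem_Icc (μ := P) (hξ t).aemeasurable
        (ae_of_all _ fun ω => hξ01 t ω)
      rwa [hmean t (by omega)] at this
    have hYeq : Y = fun ω => Real.exp (θ * (ξ t ω - μ)) * Real.exp (-(θ ^ 2 / 8)) := by
      funext ω
      rw [← Real.exp_add, ← sub_eq_add_neg]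
    have hYint : Integrable Y P := by
      rw [hYeq]
      exact (hsub.integrable_exp_mul θ).mul_const _
    have hYle : ∫ ω, Y ω ∂P ≤ 1 := by
      rw [hYeq, integral_mul_const]
      have h := hsub.mgf_le θ
      rw [mgf] at h
      refine (mul_le_mul_of_nonneg_right h (Real.exp_nonneg _)).trans_eq ?_
      rw [← Real.exp_add, ← Real.exp_zero]
      congr 1
      simp
      ring
    have hindY : IndepFun Y (fun ω => M ω * p t ω) P := by
      have h : IndepFun (ξ t) (fun ω => M ω * p t ω) P :=
        indep_of_indep_of_le_right (hind t) (hMF.mul (hpF t t le_rfl)).comap_le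
      exact h.comp (φ := fun z : ℝ => Real.exp (θ * (z - μ) - θ ^ 2 / 8)) (by fun_prop)
        measurable_id
    have hprod : Integrable (fun ω => Y ω * (M ω * p t ω)) P := hindY.integrable_mul hYint hMp
    -- since `p t` is an indicator, the last factor is `1` or `Y`
    have hsplit : (fun ω => Real.exp (θ * ∑ i ∈ Finset.range (t + 1), p i ω * (ξ i ω - μ)
        - θ ^ 2 / 8 * ∑ i ∈ Finset.range (t + 1), p i ω))
        = fun ω => (M ω - M ω * p t ω) + Y ω * (M ω * p t ω) := by
      funext ω
      rw [Finset.sum_range_succ, Finset.sum_range_succ]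
      rcases hp t ω with h | h
      · simp [h, hM]
      · rw [h, hM, hY]
        simp only [one_mul, mul_one, sub_self, zero_add]
        rw [← Real.exp_add]
        congr 1
        ring
    rw [hsplit]
    refine ⟨(hint.sub hMp).add hprod, ?_⟩
    have hMp0 : 0 ≤ ∫ ω, M ω * p t ω ∂P := integral_nonneg fun ω =>
      mul_nonneg (Real.exp_pos _).le (by rcases hp t ω with h | h <;> simp [h])
    have hmul : ∫ ω, Y ω * (M ω * p t ω) ∂P = (∫ ω, Y ω ∂P) * ∫ ω, M ω * p t ω ∂P :=
      hindY.integral_fun_mul_eq_mul_integral hYint.aestronglyMeasurable hMp.aestronglyMeasurable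
    have hsum : ∫ ω, (M ω - M ω * p t ω) + Y ω * (M ω * p t ω) ∂P
        = (∫ ω, M ω ∂P - ∫ ω, M ω * p t ω ∂P) + ∫ ω, Y ω * (M ω * p t ω) ∂P := by
      rw [← integral_sub hint hMp]
      exact integral_add (hint.sub hMp) hprod
    rw [hsum, hmul]
    nlinarith

/-- The one-sided deviation of an adaptive empirical average, in the direction `σ = ±1`: for each
possible number `h` of samples the exponential moment at `4 σ √(3 ln (t + 1) / (2 h))` gives
`(t + 1) ^ (-3)`. -/
theorem measureReal_deviation_le {ξ p : ℕ → Ω → ℝ} {F : ℕ → MeasurableSpace Ω} {μ : ℝ} {t : ℕ}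
    (hF : ∀ i, F i ≤ mΩ) (hξ : ∀ i, Measurable (ξ i)) (hξ01 : ∀ i ω, ξ i ω ∈ Set.Icc (0 : ℝ) 1)
    (hmean : ∀ i < t, ∫ ω, ξ i ω ∂P = μ) (hp : ∀ i ω, p i ω = 0 ∨ p i ω = 1)
    (hind : ∀ i, Indep (MeasurableSpace.comap (ξ i) inferInstance) (F i) P)
    (hpF : ∀ i, ∀ j ≤ i, Measurable[F i] (p j)) (hξF : ∀ i, ∀ j < i, Measurable[F i] (ξ j))
    {σ : ℝ} (hσ : σ ^ 2 = 1) {H A : Ω → ℝ} (hHnat : ∀ ω, ∃ h : ℕ, h ≤ t ∧ H ω = h)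
    (hH : ∀ ω, H ω = ∑ i ∈ Finset.range t, p i ω)
    (hA : ∀ ω, A ω * H ω = ∑ i ∈ Finset.range t, ξ i ω * p i ω) :
    P.real {ω | 0 < H ω ∧ √(3 * Real.log (t + 1 : ℕ) / (2 * H ω)) < σ * (A ω - μ)}
      ≤ t / (t + 1) ^ 3 := by
  have hone : ∀ h ∈ Finset.Icc 1 t,
      P.real {ω | H ω = h ∧ √(3 * Real.log (t + 1 : ℕ) / (2 * h)) < σ * (A ω - μ)}
        ≤ 1 / ((t : ℝ) + 1) ^ 3 := by
    intro h hh
    have hhpos : (0 : ℝ) < h := by exact_mod_cast (Finset.mem_Icc.1 hh).1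
    set L := Real.log (t + 1 : ℕ) with hL
    have hL0 : 0 ≤ L := Real.log_natCast_nonneg _
    set w := √(3 * L / (2 * h)) with hw
    have hw2 : w ^ 2 = 3 * L / (2 * h) := Real.sq_sqrt (by positivity)
    have hw0 : 0 ≤ w := Real.sqrt_nonneg _
    obtain ⟨hint, hle⟩ := integral_exp_adaptive_le_one hF hξ hξ01 hmean hp hind hpF hξF (4 * σ * w)
    have hmarkov := mul_meas_ge_le_integral_of_nonneg (ae_of_all P fun ω => (Real.exp_pos _).le)
      hint (Real.exp (3 * L))
    have hexp : Real.exp (3 * L) = ((t : ℝ) + 1) ^ 3 := by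
      rw [show 3 * L = L + L + L by ring, Real.exp_add, Real.exp_add, hL,
        Real.exp_log (by positivity)]
      push_cast
      ring
    rw [le_div_iff₀ (by positivity), ← hexp, mul_comm]
    refine le_trans ?_ (hmarkov.trans hle)
    refine mul_le_mul_of_nonneg_left (measureReal_mono ?_) (Real.exp_pos _).le
    rintro ω ⟨hHω, hdev⟩
    have hD : ∑ i ∈ Finset.range t, p i ω * (ξ i ω - μ) = h * (A ω - μ) := by
      rw [← hHω, mul_sub, mul_comm (H ω), hA, hH, Finset.sum_mul, ← Finset.sum_sub_distrib]
      exact Finset.sum_congr rfl fun i _ => by ring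
    rw [Set.mem_ofPred_eq, Real.exp_le_exp, hD, ← hH, hHω]
    have h1 : w * w ≤ w * (σ * (A ω - μ)) := mul_le_mul_of_nonneg_left hdev.le hw0
    have h2 : h * w ^ 2 = 3 * L / 2 := by rw [hw2]; field_simp
    calc 3 * L = 4 * h * (w * w) - 2 * (h * w ^ 2) := by
          rw [h2, show 4 * (h : ℝ) * (w * w) = 4 * (h * w ^ 2) by ring, h2]; ring
      _ ≤ 4 * h * (w * (σ * (A ω - μ))) - 2 * (h * w ^ 2) * σ ^ 2 := by
          rw [hσ, mul_one]
          gcongr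
      _ = _ := by ring
  calc _ ≤ P.real (⋃ h ∈ Finset.Icc 1 t,
        {ω | H ω = (h : ℕ) ∧ √(3 * Real.log (t + 1 : ℕ) / (2 * h)) < σ * (A ω - μ)}) := by
        refine measureReal_mono ?_ (measure_ne_top _ _)
        rintro ω ⟨h0, hdev⟩
        obtain ⟨h, hht, hHω⟩ := hHnat ω
        rw [hHω] at h0 hdev
        refine Set.mem_biUnion (x := h) ?_ ⟨hHω, hdev⟩
        simp only [Finset.coe_Icc, Set.mem_Icc]
        exact ⟨by exact_mod_cast h0, hht⟩
    _ ≤ ∑ h ∈ Finset.Icc 1 t, 1 / ((t : ℝ) + 1) ^ 3 :=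
        (measureReal_biUnion_finset_le _ _).trans (Finset.sum_le_sum hone)
    _ = _ := by simp [div_eq_mul_inv]

theorem sum_deviation_bound_le_one (T : ℕ) :
    ∑ t ∈ Finset.range T, (t : ℝ) / (t + 1) ^ 3 ≤ 1 := by
  have key : ∀ T : ℕ, ∑ t ∈ Finset.range (T + 1), (t : ℝ) / (t + 1) ^ 3 ≤ 1 - 1 / ((T : ℝ) + 1) := by
    intro T
    induction T with
    | zero => simp
    | succ T ih =>
      rw [Finset.sum_range_succ]
      have : ((T + 1 : ℕ) : ℝ) / ((T + 1 : ℕ) + 1) ^ 3 ≤ 1 / ((T : ℝ) + 1)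
          - 1 / ((T + 1 : ℕ) + 1) := by
        push_cast
        rw [div_sub_div _ _ (by positivity) (by positivity), div_le_div_iff₀ (by positivity)
          (by positivity)]
        have : (0 : ℝ) ≤ T := T.cast_nonneg
        ring_nf
        nlinarith [pow_nonneg this 2, pow_nonneg this 3]
      linarith
  rcases T with _ | T
  · simp
  · have := key T
    have : (0 : ℝ) ≤ 1 / ((T : ℝ) + 1) := by positivity
    linarith

end Hoeffding

/-! ### Bounded measurable random variables -/

section Bounded

variable {Ω : Type*} [MeasurableSpace Ω] {P : Measure Ω} {f g : Ω → ℝ}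

/-- Bounded measurable real functions: an algebra of functions that are integrable with respect to
every finite measure. -/
def BoundedMeasurable (f : Ω → ℝ) : Prop := Measurable f ∧ ∃ C, ∀ ω, |f ω| ≤ C

theorem BoundedMeasurable.integrable [IsFiniteMeasure P] (hf : BoundedMeasurable f) :
    Integrable f P := by
  obtain ⟨C, hC⟩ := hf.2
  exact Integrable.of_bound hf.1.aestronglyMeasurable C (ae_of_all _ hC)

theorem boundedMeasurable_of_mem_Icc {a b : ℝ} (hf : Measurable f)
    (hab : ∀ ω, f ω ∈ Set.Icc a b) : BoundedMeasurable f :=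
  ⟨hf, max |a| |b|, fun ω => abs_le_max_abs_abs (hab ω).1 (hab ω).2⟩

theorem boundedMeasurable_const (a : ℝ) : BoundedMeasurable fun _ : Ω => a :=
  ⟨measurable_const, |a|, fun _ => le_rfl⟩

theorem BoundedMeasurable.add (hf : BoundedMeasurable f) (hg : BoundedMeasurable g) :
    BoundedMeasurable fun ω => f ω + g ω := by
  obtain ⟨hf, C, hC⟩ := hf
  obtain ⟨hg, D, hD⟩ := hg
  exact ⟨hf.add hg, C + D, fun ω => (abs_add_le _ _).trans (add_le_add (hC ω) (hD ω))⟩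

theorem BoundedMeasurable.mul (hf : BoundedMeasurable f) (hg : BoundedMeasurable g) :
    BoundedMeasurable fun ω => f ω * g ω := by
  obtain ⟨hf, C, hC⟩ := hf
  obtain ⟨hg, D, hD⟩ := hg
  refine ⟨hf.mul hg, C * D, fun ω => ?_⟩
  rw [abs_mul]
  exact mul_le_mul (hC ω) (hD ω) (abs_nonneg _) ((abs_nonneg _).trans (hC ω))

theorem BoundedMeasurable.sub (hf : BoundedMeasurable f) (hg : BoundedMeasurable g) :
    BoundedMeasurable fun ω => f ω - g ω := by
  have := hf.add ((boundedMeasurable_const (-1)).mul hg)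
  simpa [sub_eq_add_neg] using this

theorem BoundedMeasurable.sum {ι : Type*} {s : Finset ι} {f : ι → Ω → ℝ}
    (hf : ∀ i, BoundedMeasurable (f i)) : BoundedMeasurable fun ω => ∑ i ∈ s, f i ω := by
  choose hm C hC using hf
  exact ⟨Finset.measurable_fun_sum _ fun i _ => hm i, ∑ i ∈ s, C i, fun ω =>
    (Finset.abs_sum_le_sum_abs _ _).trans (Finset.sum_le_sum fun i _ => hC i ω)⟩

theorem BoundedMeasurable.max_zero (hf : BoundedMeasurable f) :
    BoundedMeasurable fun ω => max (f ω) 0 := by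
  obtain ⟨hf, C, hC⟩ := hf
  refine ⟨hf.max measurable_const, C, fun ω => ?_⟩
  rw [abs_of_nonneg (le_max_right _ _)]
  exact max_le ((le_abs_self _).trans (hC ω)) ((abs_nonneg _).trans (hC ω))

theorem integral_sqrt_le_sqrt_integral [IsProbabilityMeasure P] (hf : BoundedMeasurable f)
    (hf0 : ∀ ω, 0 ≤ f ω) :
    BoundedMeasurable (fun ω => √(f ω)) ∧ ∫ ω, √(f ω) ∂P ≤ √(∫ ω, f ω ∂P) := by
  obtain ⟨C, hC⟩ := hf.2
  have hb : BoundedMeasurable (fun ω => √(f ω)) :=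
    boundedMeasurable_of_mem_Icc hf.1.sqrt fun ω =>
      ⟨Real.sqrt_nonneg _, Real.sqrt_le_sqrt ((le_abs_self _).trans (hC ω))⟩
  exact ⟨hb, Real.strictConcaveOn_sqrt.concaveOn.le_map_integral Real.continuous_sqrt.continuousOn
    isClosed_Ici (ae_of_all _ hf0) hf.integrable hb.integrable⟩

end Bounded

/-! ### The stochastic environment -/

/-- The probabilistic assumptions: the reward vectors in `[0, 1]` and the cost matrices in `[0, 1]`
are independent and identically distributed over the slots `1, …, T`, and independent of each
other. -/
structure IsEnvironment {Ω : Type*} [MeasurableSpace Ω] (P : Measure Ω) (T : ℕ)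
    (r : ℕ → Ω → Fin K → ℝ) (c : ℕ → Ω → Mat N K) : Prop where
  measurable_reward : ∀ t, Measurable (r t)
  reward_mem : ∀ t ω k, r t ω k ∈ Set.Icc (0 : ℝ) 1
  indep_reward : iIndepFun r P
  ident_reward : ∀ t ∈ Finset.Icc 1 T, IdentDistrib (r t) (r 1) P P
  measurable_cost : ∀ t, Measurable (c t)
  cost_mem : ∀ t ω n k, c t ω n k ∈ Set.Icc (0 : ℝ) 1
  indep_cost : iIndepFun c P
  ident_cost : ∀ t ∈ Finset.Icc 1 T, IdentDistrib (c t) (c 1) P P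
  indep_reward_cost : IndepFun (fun ω t => r t ω) (fun ω t => c t ω) P

/-- The state of the mechanism at the end of slot `t` as a random variable, for truthful bids. -/
noncomputable abbrev stateAt {Ω : Type*} (φ : Fin N → ℝ) (η : ℝ) (sel : Rule N K)
    (c : ℕ → Ω → Mat N K) (r : ℕ → Ω → Fin K → ℝ) (t : ℕ) (ω : Ω) : State N K :=
  state φ η sel (fun s => c s ω) (fun s => c s ω) (fun s => r s ω) t

/-- The assignment in slot `t` as a random variable, for truthful bids. -/
noncomputable abbrev assignmentAt {Ω : Type*} (φ : Fin N → ℝ) (η : ℝ) (sel : Rule N K)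
    (c : ℕ → Ω → Mat N K) (r : ℕ → Ω → Fin K → ℝ) (t : ℕ) (ω : Ω) : Mat N K :=
  xHat φ η sel (fun s => c s ω) (fun s => c s ω) (fun s => r s ω) t

theorem measurable_assignmentAt_history {Ω : Type*} {φ : Fin N → ℝ} {η : ℝ} {sel : Rule N K}
    (hsel : IsMaximizingRule φ sel) (r : ℕ → Ω → Fin K → ℝ) (c : ℕ → Ω → Mat N K) {s t : ℕ}
    (hst : s ≤ t) :
    Measurable[history r (fun ω t => c t ω) (t + 1)] (assignmentAt φ η sel c r (s + 1)) :=
  @measurable_xHat_succ _ _ _ _ _ _ (history r (fun ω t => c t ω) (t + 1)) hsel c r s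
    (fun i _ => (measurable_pi_apply i).comp (measurable_history_right r (fun ω t => c t ω) _))
    fun i hi => measurable_history_left r (fun ω t => c t ω) (by omega)

section Environment

variable {Ω : Type*} [MeasurableSpace Ω] {P : Measure Ω} {T : ℕ}
  {φ : Fin N → ℝ} {η : ℝ} {sel : Rule N K} {r : ℕ → Ω → Fin K → ℝ} {c : ℕ → Ω → Mat N K}

theorem lam_le (hη : 0 ≤ η) (hφ : ∀ n, φ n ∈ Set.Icc (0 : ℝ) 1) (hsel : IsMaximizingRule φ sel)
    (c : ℕ → Mat N K) (r : ℕ → Fin K → ℝ) (t : ℕ) (n : Fin N) :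
    (state φ η sel c c r t).lam n ≤ η * t := by
  induction t with
  | zero => simp [state]
  | succ t ih =>
    rw [lam_succ]
    have := (xHat_mem c r hsel (t + 1) (η := η)).2.1 n
    refine max_le ?_ (by positivity)
    push_cast
    nlinarith [(hφ n).1]

namespace IsEnvironment

theorem boundedMeasurable_reward (E : IsEnvironment P T r c) (t : ℕ) (k : Fin K) :
    BoundedMeasurable fun ω => r t ω k :=
  boundedMeasurable_of_mem_Icc ((measurable_pi_apply k).comp (E.measurable_reward t))
    fun ω => E.reward_mem t ω k

theorem boundedMeasurable_cost (E : IsEnvironment P T r c) (t : ℕ) (n : Fin N) (k : Fin K) :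
    BoundedMeasurable fun ω => c t ω n k :=
  boundedMeasurable_of_mem_Icc
    ((measurable_pi_apply k).comp ((measurable_pi_apply n).comp (E.measurable_cost t)))
    fun ω => E.cost_mem t ω n k

theorem measurable_assignmentAt (E : IsEnvironment P T r c)
    (hsel : IsMaximizingRule φ sel) (t : ℕ) :
    Measurable (assignmentAt φ η sel c r (t + 1)) :=
  measurable_xHat_succ hsel t (fun s _ => E.measurable_cost s) fun s _ => E.measurable_reward s

theorem boundedMeasurable_assignmentAt (E : IsEnvironment P T r c)
    (hsel : IsMaximizingRule φ sel) (t : ℕ) (n : Fin N) (k : Fin K) :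
    BoundedMeasurable fun ω => assignmentAt φ η sel c r (t + 1) ω n k :=
  boundedMeasurable_of_mem_Icc (a := 0) (b := 1)
    ((measurable_pi_apply k).comp
      ((measurable_pi_apply n).comp (E.measurable_assignmentAt hsel t)))
    fun _ => ⟨nonneg_of_mem_assignments (xHat_mem _ _ hsel _) n k,
      le_one_of_mem_assignments (xHat_mem _ _ hsel _) n k⟩

theorem boundedMeasurable_lam (E : IsEnvironment P T r c)
    (hsel : IsMaximizingRule φ sel) (hη : 0 ≤ η) (hφ : ∀ n, φ n ∈ Set.Icc (0 : ℝ) 1) (t : ℕ)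
    (n : Fin N) : BoundedMeasurable fun ω => (stateAt φ η sel c r t ω).lam n :=
  boundedMeasurable_of_mem_Icc
    ((measurable_pi_apply n).comp (measurable_state hsel t (fun s _ => E.measurable_cost s)
      fun s _ => E.measurable_reward s).1)
    fun _ => ⟨lam_nonneg _ _ t n, lam_le hη hφ hsel _ _ t n⟩

theorem boundedMeasurable_count (E : IsEnvironment P T r c)
    (hsel : IsMaximizingRule φ sel) (t : ℕ) (k : Fin K) :
    BoundedMeasurable fun ω => (stateAt φ η sel c r t ω).count k := by
  simp only [count_eq_sum _ _ hsel]
  exact BoundedMeasurable.sum fun s => BoundedMeasurable.sum fun n =>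
    E.boundedMeasurable_assignmentAt hsel s n k

theorem boundedMeasurable_estimate (E : IsEnvironment P T r c)
    (hsel : IsMaximizingRule φ sel) (t : ℕ) (k : Fin K) :
    BoundedMeasurable fun ω => estimate (t + 1) (stateAt φ η sel c r t ω) k := by
  obtain ⟨-, hn, ha⟩ := measurable_state hsel (η := η) t (fun s _ => E.measurable_cost s)
    fun s _ => E.measurable_reward s
  refine boundedMeasurable_of_mem_Icc (a := 0) (b := 1)
    ((measurable_pi_apply k).comp (measurable_estimate (t + 1) hn ha)) fun ω =>
    ⟨estimate_nonneg _ (fun k => avg_nonneg _ _ hsel (fun t k => (E.reward_mem t ω k).1) t k) k,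
      estimate_le_one _ _ _⟩

theorem measurableSet_overestimated (E : IsEnvironment P T r c)
    (hsel : IsMaximizingRule φ sel) (t : ℕ) (k : Fin K) (μ : ℝ) :
    MeasurableSet {ω | Overestimated (t + 1) (stateAt φ η sel c r t ω) k μ} := by
  obtain ⟨-, hn, ha⟩ := measurable_state hsel (η := η) t (fun s _ => E.measurable_cost s)
    fun s _ => E.measurable_reward s
  have h1 : Measurable fun ω => (stateAt φ η sel c r t ω).count k :=
    (measurable_pi_apply k).comp hn
  have h2 : Measurable fun ω => (stateAt φ η sel c r t ω).avg k := (measurable_pi_apply k).comp ha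
  exact (measurableSet_lt measurable_const h1).inter (measurableSet_lt (by fun_prop) h2)

theorem measurableSet_underestimated (E : IsEnvironment P T r c)
    (hsel : IsMaximizingRule φ sel) (t : ℕ) (k : Fin K) (μ : ℝ) :
    MeasurableSet {ω | Underestimated (t + 1) (stateAt φ η sel c r t ω) k μ} := by
  obtain ⟨-, hn, ha⟩ := measurable_state hsel (η := η) t (fun s _ => E.measurable_cost s)
    fun s _ => E.measurable_reward s
  have h1 : Measurable fun ω => (stateAt φ η sel c r t ω).count k :=
    (measurable_pi_apply k).comp hn
  have h2 : Measurable fun ω => (stateAt φ η sel c r t ω).avg k := (measurable_pi_apply k).comp ha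
  have h3 : Measurable fun ω => (stateAt φ η sel c r t ω).avg k
      + √(3 * Real.log (t + 1 : ℕ) / (2 * (stateAt φ η sel c r t ω).count k)) := by fun_prop
  exact (measurableSet_lt measurable_const h1).inter (measurableSet_lt h3 measurable_const)

theorem integral_reward (E : IsEnvironment P T r c) (t : ℕ) (ht : t < T) (k : Fin K) :
    ∫ ω, r (t + 1) ω k ∂P = ∫ ω, r 1 ω k ∂P :=
  ((E.ident_reward (t + 1) (Finset.mem_Icc.2 ⟨by omega, by omega⟩)).comp
    (measurable_pi_apply k)).integral_eq

variable [IsProbabilityMeasure P]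

theorem indepFun_reward_assignmentAt (E : IsEnvironment P T r c)
    (hsel : IsMaximizingRule φ sel) (t : ℕ) :
    IndepFun (r (t + 1)) (assignmentAt φ η sel c r (t + 1)) P :=
  indepFun_of_measurable_history E.measurable_reward (measurable_pi_lambda _ E.measurable_cost)
    E.indep_reward E.indep_reward_cost (measurable_assignmentAt_history hsel r c le_rfl)

/-- The costs of slot `t + 1` are independent of the multipliers in force in that slot. -/
theorem indepFun_cost_lam (E : IsEnvironment P T r c)
    (hsel : IsMaximizingRule φ sel) (t : ℕ) :
    IndepFun (c (t + 1)) (fun ω => (stateAt φ η sel c r t ω).lam) P :=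
  indepFun_of_measurable_history E.measurable_cost (measurable_pi_lambda _ E.measurable_reward)
    E.indep_cost E.indep_reward_cost.symm
    (@measurable_state _ _ _ _ _ _ (history c (fun ω t => r t ω) (t + 1)) hsel c r t
      (fun s hs => measurable_history_left c (fun ω t => r t ω) (by omega))
      fun s _ => (measurable_pi_apply s).comp
        (measurable_history_right c (fun ω t => r t ω) _)).1

theorem measureReal_deviation (E : IsEnvironment P T r c)
    (hsel : IsMaximizingRule φ sel) {t : ℕ} (ht : t ≤ T) (k : Fin K) {σ : ℝ} (hσ : σ ^ 2 = 1) :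
    P.real {ω | 0 < (stateAt φ η sel c r t ω).count k ∧
      √(3 * Real.log (t + 1 : ℕ) / (2 * (stateAt φ η sel c r t ω).count k))
        < σ * ((stateAt φ η sel c r t ω).avg k - ∫ ω, r 1 ω k ∂P)}
      ≤ t / (t + 1) ^ 3 := by
  have hC : Measurable fun ω t => c t ω := measurable_pi_lambda _ E.measurable_cost
  have hrk : ∀ t, Measurable fun ω => r t ω k := fun t =>
    (measurable_pi_apply k).comp (E.measurable_reward t)
  refine measureReal_deviation_le (ξ := fun i ω => r (i + 1) ω k)
    (p := fun i ω => ∑ n, assignmentAt φ η sel c r (i + 1) ω n k)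
    (F := fun i => history r (fun ω t => c t ω) (i + 1)) ?_ ?_ ?_ ?_ ?_ ?_ ?_ ?_ hσ ?_ ?_ ?_
  · exact fun i => history_le E.measurable_reward hC _
  · exact fun i => hrk _
  · exact fun i ω => E.reward_mem _ ω k
  · exact fun i hi => E.integral_reward i (by omega) k
  · exact fun i ω => col_sum_eq_zero_or_one (xHat_mem _ _ hsel _) k
  · intro i
    refine indep_of_indep_of_le_left
      (indep_history E.measurable_reward hC E.indep_reward E.indep_reward_cost (i + 1)) ?_
    exact ((measurable_pi_apply k).comp (comap_measurable (r (i + 1)))).comap_le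
  · intro i j hj
    have h := measurable_assignmentAt_history (η := η) hsel r c hj
    exact Finset.measurable_fun_sum _ fun n _ =>
      (measurable_pi_apply k).comp ((measurable_pi_apply n).comp h)
  · exact fun i j hj => (measurable_pi_apply k).comp
      (measurable_history_left r (fun ω t => c t ω) (by omega))
  · exact fun ω => count_mem_nat _ _ hsel t k
  · exact fun ω => count_eq_sum _ _ hsel t k
  · exact fun ω => avg_mul_count _ _ hsel t k

theorem measureReal_overestimated_le (E : IsEnvironment P T r c)
    (hsel : IsMaximizingRule φ sel) {t : ℕ} (ht : t ≤ T) (k : Fin K) :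
    P.real {ω | Overestimated (t + 1) (stateAt φ η sel c r t ω) k (∫ ω, r 1 ω k ∂P)}
      ≤ t / (t + 1) ^ 3 := by
  refine (measureReal_mono ?_).trans (E.measureReal_deviation hsel ht k (σ := 1) (by norm_num))
  rintro ω ⟨h1, h2⟩
  exact ⟨h1, by linarith⟩

theorem measureReal_underestimated_le (E : IsEnvironment P T r c)
    (hsel : IsMaximizingRule φ sel) {t : ℕ} (ht : t ≤ T) (k : Fin K) :
    P.real {ω | Underestimated (t + 1) (stateAt φ η sel c r t ω) k (∫ ω, r 1 ω k ∂P)}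
      ≤ t / (t + 1) ^ 3 := by
  refine (measureReal_mono ?_).trans (E.measureReal_deviation hsel ht k (σ := -1) (by norm_num))
  rintro ω ⟨h1, h2⟩
  exact ⟨h1, by linarith⟩

end IsEnvironment

end Environment

/-! ### Expected cost of learning the rewards -/

section Expectation

variable {Ω : Type*} [MeasurableSpace Ω] {P : Measure Ω} {T : ℕ}
  {φ : Fin N → ℝ} {η : ℝ} {sel : Rule N K} {r : ℕ → Ω → Fin K → ℝ} {c : ℕ → Ω → Mat N K}

open Classical in
theorem boundedMeasurable_ite {p : Ω → Prop} (hp : MeasurableSet {ω | p ω}) :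
    BoundedMeasurable fun ω => if p ω then (1 : ℝ) else 0 :=
  boundedMeasurable_of_mem_Icc (a := 0) (b := 1)
    (Measurable.ite hp measurable_const measurable_const) fun ω => by
      split_ifs <;> simp

open Classical in
theorem integral_ite_one {p : Ω → Prop} (hp : MeasurableSet {ω | p ω}) :
    ∫ ω, (if p ω then (1 : ℝ) else 0) ∂P = P.real {ω | p ω} := by
  rw [← integral_indicator_one hp]
  exact integral_congr_ae (ae_of_all _ fun ω => by simp [Set.indicator_apply])

theorem boundedMeasurable_gap (E : IsEnvironment P T r c) (hsel : IsMaximizingRule φ sel)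
    (μ : Fin K → ℝ) (t : ℕ) (k : Fin K) :
    BoundedMeasurable fun ω => (estimate (t + 1) (stateAt φ η sel c r t ω) k - μ k)
      * ∑ n, assignmentAt φ η sel c r (t + 1) ω n k :=
  ((E.boundedMeasurable_estimate hsel t k).sub (boundedMeasurable_const _)).mul
    (BoundedMeasurable.sum fun n => E.boundedMeasurable_assignmentAt hsel t n k)

theorem boundedMeasurable_reward_one (E : IsEnvironment P T r c) (hsel : IsMaximizingRule φ sel)
    (t : ℕ) : BoundedMeasurable fun ω =>
      reward (assignmentAt φ η sel c r (t + 1) ω) 1 (r (t + 1) ω) := by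
  simp only [reward, Pi.one_apply, mul_one]
  exact BoundedMeasurable.sum fun k => BoundedMeasurable.sum fun n =>
    (E.boundedMeasurable_reward (t + 1) k).mul (E.boundedMeasurable_assignmentAt hsel t n k)

variable [IsProbabilityMeasure P]

/-- The expected number of assigned pulls, in terms of the fairness violation. -/
theorem integral_sum_count_le (E : IsEnvironment P T r c) (hsel : IsMaximizingRule φ sel) :
    ∫ ω, ∑ k, (stateAt φ η sel c r T ω).count k ∂P ≤ T * bigPhi φ
      + ∑ n, ∫ ω, max (∑ t ∈ Finset.range T,
          (∑ k, assignmentAt φ η sel c r (t + 1) ω n k - φ n)) 0 ∂P := by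
  have hb : ∀ n, BoundedMeasurable fun ω => max (∑ t ∈ Finset.range T,
      (∑ k, assignmentAt φ η sel c r (t + 1) ω n k - φ n)) 0 := fun n =>
    (BoundedMeasurable.sum fun t => (BoundedMeasurable.sum fun k =>
      E.boundedMeasurable_assignmentAt hsel t n k).sub (boundedMeasurable_const _)).max_zero
  rw [← integral_finsetSum _ fun n _ => (hb n).integrable]
  have hconst : (T : ℝ) * bigPhi φ = ∫ _, (T : ℝ) * bigPhi φ ∂P := by simp
  rw [hconst, ← integral_add (integrable_const _) (BoundedMeasurable.sum hb).integrable]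
  refine integral_mono (BoundedMeasurable.sum fun k =>
      E.boundedMeasurable_count hsel T k).integrable
    ((boundedMeasurable_const _).add (BoundedMeasurable.sum hb)).integrable fun ω => ?_
  simp only [count_eq_sum _ _ hsel]
  calc ∑ k, ∑ t ∈ Finset.range T, ∑ n, assignmentAt φ η sel c r (t + 1) ω n k
      = ∑ n, ∑ t ∈ Finset.range T, ∑ k, assignmentAt φ η sel c r (t + 1) ω n k := by
        rw [Finset.sum_comm]
        simp only [Finset.sum_comm (s := (Finset.univ : Finset (Fin K)))]
        rw [Finset.sum_comm]
    _ = ∑ n, (T * φ n + ∑ t ∈ Finset.range T,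
          (∑ k, assignmentAt φ η sel c r (t + 1) ω n k - φ n)) := by
        refine Finset.sum_congr rfl fun n _ => ?_
        rw [Finset.sum_sub_distrib]
        simp
    _ ≤ ∑ n, (T * φ n + max (∑ t ∈ Finset.range T,
          (∑ k, assignmentAt φ η sel c r (t + 1) ω n k - φ n)) 0) := by
        gcongr
        exact le_max_left _ _
    _ = _ := by rw [Finset.sum_add_distrib, ← Finset.mul_sum, bigPhi]

theorem mean_reward_mem (E : IsEnvironment P T r c) (k : Fin K) :
    ∫ ω, r 1 ω k ∂P ∈ Set.Icc (0 : ℝ) 1 := by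
  refine ⟨integral_nonneg fun ω => (E.reward_mem 1 ω k).1, ?_⟩
  refine (integral_mono (E.boundedMeasurable_reward 1 k).integrable (integrable_const 1)
    fun ω => (E.reward_mem 1 ω k).2).trans (by simp)

open Classical in
/-- The total optimism of the estimates over the pulled arms. Per arm, the first pull and the
expected number of overestimations each cost at most `1`; the confidence radii are summed by the
Cauchy-Schwarz and Jensen inequalities. -/
theorem integral_gap_le (E : IsEnvironment P T r c) (hsel : IsMaximizingRule φ sel) :
    ∑ t ∈ Finset.range T, ∫ ω, ∑ k, (estimate (t + 1) (stateAt φ η sel c r t ω) k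
        - ∫ ω, r 1 ω k ∂P) * ∑ n, assignmentAt φ η sel c r (t + 1) ω n k ∂P
      ≤ 2 * K + 2 * √(6 * K * (T * bigPhi φ + ∑ n, ∫ ω, max (∑ t ∈ Finset.range T,
          (∑ k, assignmentAt φ η sel c r (t + 1) ω n k - φ n)) 0 ∂P) * Real.log T) := by
  set μ : Fin K → ℝ := fun k => ∫ ω, r 1 ω k ∂P with hμ
  set D := T * bigPhi φ + ∑ n, ∫ ω, max (∑ t ∈ Finset.range T,
          (∑ k, assignmentAt φ η sel c r (t + 1) ω n k - φ n)) 0 ∂P with hD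
  set Z : Ω → ℝ := fun ω => ∑ k, (stateAt φ η sel c r T ω).count k with hZ
  have hZb : BoundedMeasurable Z := BoundedMeasurable.sum fun k =>
    E.boundedMeasurable_count hsel T k
  have hZ0 : ∀ ω, 0 ≤ Z ω := fun ω => Finset.sum_nonneg fun k _ => count_nonneg _ _ hsel T k
  have hlog : 0 ≤ Real.log T := Real.log_natCast_nonneg T
  have hover : ∀ k t, BoundedMeasurable fun ω =>
      if Overestimated (t + 1) (stateAt φ η sel c r t ω) k (μ k) then (1 : ℝ) else 0 := fun k t =>
    boundedMeasurable_ite (E.measurableSet_overestimated hsel t k (μ k))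
  have hsqrt := integral_sqrt_le_sqrt_integral (P := P) hZb hZ0
  have hpath : ∀ ω, ∑ t ∈ Finset.range T, ∑ k,
      (estimate (t + 1) (stateAt φ η sel c r t ω) k - μ k)
        * ∑ n, assignmentAt φ η sel c r (t + 1) ω n k
      ≤ K + ∑ k, ∑ t ∈ Finset.range T,
          (if Overestimated (t + 1) (stateAt φ η sel c r t ω) k (μ k) then (1 : ℝ) else 0)
        + 2 * √(6 * K * Real.log T) * √(Z ω) := by
    intro ω
    rw [Finset.sum_comm]
    refine (Finset.sum_le_sum fun k _ => sum_estimate_sub_mul_le _ _ hsel k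
      (mean_reward_mem E k).1 T).trans ?_
    rw [Finset.sum_add_distrib, Finset.sum_add_distrib, ← Finset.mul_sum]
    have hcs : ∑ k, √((stateAt φ η sel c r T ω).count k) ≤ √K * √(Z ω) := by
      have h := Real.sum_mul_le_sqrt_mul_sqrt Finset.univ (fun _ : Fin K => (1 : ℝ))
        fun k => √((stateAt φ η sel c r T ω).count k)
      simp only [one_mul, one_pow, Finset.sum_const, Finset.card_univ, Fintype.card_fin,
        nsmul_eq_mul, mul_one, Real.sq_sqrt (count_nonneg _ _ hsel T _)] at h
      exact h
    have h6 : √(6 * K * Real.log T) = √(6 * Real.log T) * √K := by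
      rw [← Real.sqrt_mul (by positivity)]
      ring_nf
    rw [h6]
    have := mul_le_mul_of_nonneg_left hcs (show 0 ≤ 2 * √(6 * Real.log T) by positivity)
    simp only [Finset.sum_const, Finset.card_univ, Fintype.card_fin, nsmul_eq_mul, mul_one]
    linarith
  have hgap := fun t => BoundedMeasurable.sum (s := Finset.univ) fun k =>
    boundedMeasurable_gap (η := η) E hsel μ t k
  rw [← integral_finsetSum _ fun t _ => (hgap t).integrable]
  have hover' : BoundedMeasurable fun ω => ∑ k, ∑ t ∈ Finset.range T,
      (if Overestimated (t + 1) (stateAt φ η sel c r t ω) k (μ k) then (1 : ℝ) else 0) :=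
    BoundedMeasurable.sum fun k => BoundedMeasurable.sum fun t => hover k t
  have hroot : BoundedMeasurable fun ω => 2 * √(6 * K * Real.log T) * √(Z ω) :=
    (boundedMeasurable_const _).mul hsqrt.1
  refine (integral_mono (BoundedMeasurable.sum hgap).integrable
    (((boundedMeasurable_const _).add hover').add hroot).integrable hpath).trans ?_
  rw [integral_add ((boundedMeasurable_const _).add hover').integrable hroot.integrable,
    integral_add (integrable_const _) hover'.integrable, integral_const_mul,
    integral_finsetSum _ fun k _ => (BoundedMeasurable.sum fun t => hover k t).integrable]
  have hprob : ∑ k, ∫ ω, ∑ t ∈ Finset.range T,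
      (if Overestimated (t + 1) (stateAt φ η sel c r t ω) k (μ k) then (1 : ℝ) else 0) ∂P
      ≤ K := by
    refine (Finset.sum_le_sum fun k _ => (?_ : _ ≤ (1 : ℝ))).trans (by simp)
    rw [integral_finsetSum _ fun t _ => (hover k t).integrable]
    refine (Finset.sum_le_sum fun t ht => ?_).trans (sum_deviation_bound_le_one T)
    rw [integral_ite_one (E.measurableSet_overestimated hsel t k (μ k))]
    exact E.measureReal_overestimated_le hsel (Finset.mem_range.1 ht).le k
  have hlast : 2 * √(6 * K * Real.log T) * ∫ ω, √(Z ω) ∂P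
      ≤ 2 * √(6 * K * D * Real.log T) := by
    have h1 : √(6 * K * D * Real.log T) = √(6 * K * Real.log T) * √D := by
      rw [← Real.sqrt_mul (by positivity)]
      ring_nf
    rw [h1, ← mul_assoc]
    exact mul_le_mul_of_nonneg_left
      (hsqrt.2.trans (Real.sqrt_le_sqrt (integral_sum_count_le E hsel))) (by positivity)
  simp only [integral_const, probReal_univ, smul_eq_mul, one_mul]
  linarith

/-! ### Regret in a slot -/

/-- The optimality of the assignment in a slot, compared with an assignment `z`; `U k` bounds how
much the estimate `e k` falls short of `μ k`. -/
theorem welfare_comparison {lam : Fin N → ℝ} {e μ U : Fin K → ℝ} {C x z : Mat N K}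
    (hz : z ∈ assignments N K)
    (hopt : lagrangian φ lam e C z ≤ lagrangian φ lam e C x) (hU : ∀ k, μ k - e k ≤ U k)
    (hU0 : ∀ k, 0 ≤ U k) :
    ∑ k, ∑ n, (μ k - C n k) * z n k
      ≤ ∑ k, ∑ n, (μ k - C n k) * x n k + ∑ k, U k + ∑ k, (e k - μ k) * ∑ n, x n k
        - ∑ n, lam n * (∑ k, x n k - φ n) + ∑ n, lam n * (∑ k, z n k - φ n) := by
  have hexp : ∀ w : Mat N K, lagrangian φ lam e C w
      = ∑ k, ∑ n, (μ k - C n k) * w n k + ∑ k, (e k - μ k) * ∑ n, w n k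
        - ∑ n, lam n * (∑ k, w n k - φ n) := by
    intro w
    rw [lagrangian_eq_sum, Finset.sum_comm (s := (Finset.univ : Finset (Fin K)))]
    simp only [Finset.mul_sum, mul_sub, sub_mul, Finset.sum_sub_distrib]
    rw [Finset.sum_comm (f := fun k n => μ k * w n k), Finset.sum_comm (f := fun k n => e k * w n k)]
    ring
  rw [hexp, hexp] at hopt
  have : ∑ k, (μ k - e k) * ∑ n, z n k ≤ ∑ k, U k := by
    refine Finset.sum_le_sum fun k _ => ?_
    have h0 := col_sum_nonneg hz k
    nlinarith [hU k, hU0 k, hz.2.2 k, mul_le_mul_of_nonneg_right (hU k) h0]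
  have h2 : ∑ k, (μ k - e k) * ∑ n, z n k = -∑ k, (e k - μ k) * ∑ n, z n k := by
    rw [← Finset.sum_neg_distrib]
    exact Finset.sum_congr rfl fun k _ => by ring
  linarith

theorem integral_reward_mul (E : IsEnvironment P T r c) (hsel : IsMaximizingRule φ sel) {t : ℕ}
    (ht : t < T) (n : Fin N) (k : Fin K) :
    ∫ ω, r (t + 1) ω k * assignmentAt φ η sel c r (t + 1) ω n k ∂P
      = ∫ ω, (∫ ω, r 1 ω k ∂P) * assignmentAt φ η sel c r (t + 1) ω n k ∂P := by
  have h : IndepFun (fun ω => r (t + 1) ω k)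
      (fun ω => assignmentAt φ η sel c r (t + 1) ω n k) P :=
    (E.indepFun_reward_assignmentAt hsel t).comp (measurable_pi_apply k)
      ((measurable_pi_apply k).comp (measurable_pi_apply n))
  rw [h.integral_fun_mul_eq_mul_integral
    (E.boundedMeasurable_reward _ k).1.aestronglyMeasurable
    (E.boundedMeasurable_assignmentAt hsel t n k).1.aestronglyMeasurable,
    integral_const_mul, E.integral_reward t ht k]

/-- In expectation, the rewards of a slot may be replaced by their means, as the assignment does not
depend on them. -/
theorem integral_reward_one (E : IsEnvironment P T r c) (hsel : IsMaximizingRule φ sel) {t : ℕ}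
    (ht : t < T) :
    ∫ ω, reward (assignmentAt φ η sel c r (t + 1) ω) 1 (r (t + 1) ω) ∂P
      = ∫ ω, ∑ k, ∑ n, (∫ ω, r 1 ω k ∂P) * assignmentAt φ η sel c r (t + 1) ω n k ∂P := by
  have hX := fun n k => E.boundedMeasurable_assignmentAt (η := η) hsel t n k
  have h1 := fun k n => (E.boundedMeasurable_reward (t + 1) k).mul (hX n k)
  have h2 := fun k n => (boundedMeasurable_const (∫ ω, r 1 ω k ∂P)).mul (hX n k)
  simp only [reward, Pi.one_apply, mul_one]
  rw [integral_finsetSum _ fun k _ => (BoundedMeasurable.sum (h1 k)).integrable,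
    integral_finsetSum _ fun k _ => (BoundedMeasurable.sum (h2 k)).integrable]
  refine Finset.sum_congr rfl fun k _ => ?_
  rw [integral_finsetSum _ fun n _ => (h1 k n).integrable,
    integral_finsetSum _ fun n _ => (h2 k n).integrable]
  exact Finset.sum_congr rfl fun n _ => integral_reward_mul E hsel ht n k

theorem integral_welfare_one (E : IsEnvironment P T r c) (hsel : IsMaximizingRule φ sel) {t : ℕ}
    (ht : t < T) :
    ∫ ω, welfare (assignmentAt φ η sel c r (t + 1) ω) 1 (r (t + 1) ω) (c (t + 1) ω) ∂P
      = ∫ ω, ∑ k, ∑ n, ((∫ ω, r 1 ω k ∂P) - c (t + 1) ω n k)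
          * assignmentAt φ η sel c r (t + 1) ω n k ∂P := by
  have hX := fun n k => E.boundedMeasurable_assignmentAt (η := η) hsel t n k
  have hcost : BoundedMeasurable fun ω =>
      ∑ k, ∑ n, c (t + 1) ω n k * assignmentAt φ η sel c r (t + 1) ω n k :=
    BoundedMeasurable.sum fun k => BoundedMeasurable.sum fun n =>
      (E.boundedMeasurable_cost (t + 1) n k).mul (hX n k)
  have hmean : BoundedMeasurable fun ω =>
      ∑ k, ∑ n, (∫ ω, r 1 ω k ∂P) * assignmentAt φ η sel c r (t + 1) ω n k :=
    BoundedMeasurable.sum fun k => BoundedMeasurable.sum fun n =>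
      (boundedMeasurable_const _).mul (hX n k)
  have hc : ∀ ω, cost (assignmentAt φ η sel c r (t + 1) ω) 1 (c (t + 1) ω)
      = ∑ k, ∑ n, c (t + 1) ω n k * assignmentAt φ η sel c r (t + 1) ω n k := fun ω => by
    simp only [cost, Pi.one_apply, mul_one]
    exact Finset.sum_comm
  simp only [welfare, hc, sub_mul, Finset.sum_sub_distrib]
  rw [integral_sub (boundedMeasurable_reward_one E hsel t).integrable hcost.integrable,
    integral_sub hmean.integrable hcost.integrable, integral_reward_one E hsel ht]

/-- A policy that is fair in expectation does not violate the fairness constraints weighted by the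
current multipliers, because these are independent of the current costs. -/
theorem integral_lam_mul_policy_nonpos (E : IsEnvironment P T r c)
    (hsel : IsMaximizingRule φ sel) (hη : 0 ≤ η) (hφ : ∀ n, φ n ∈ Set.Icc (0 : ℝ) 1)
    {z : Mat N K → Mat N K} (hz : Measurable z) (hzm : ∀ C, z C ∈ assignments N K)
    {t : ℕ} (ht : t < T) (hfair : ∀ n, ∫ C, utilization (z C) 1 n ∂P.map (c 1) ≤ φ n) :
    ∫ ω, ∑ n, (stateAt φ η sel c r t ω).lam n * (∑ k, z (c (t + 1) ω) n k - φ n) ∂P ≤ 0 := by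
  have hznk : ∀ n k, Measurable fun C => z C n k := fun n k =>
    (measurable_pi_apply k).comp ((measurable_pi_apply n).comp hz)
  have hZ : ∀ n k, BoundedMeasurable fun ω => z (c (t + 1) ω) n k := fun n k =>
    boundedMeasurable_of_mem_Icc (a := 0) (b := 1) ((hznk n k).comp (E.measurable_cost _))
      fun ω => ⟨nonneg_of_mem_assignments (hzm _) n k, le_one_of_mem_assignments (hzm _) n k⟩
  have hf : ∀ n, BoundedMeasurable fun ω => ∑ k, z (c (t + 1) ω) n k - φ n := fun n =>
    (BoundedMeasurable.sum fun k => hZ n k).sub (boundedMeasurable_const _)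
  have hlam := E.boundedMeasurable_lam hsel hη hφ t
  rw [integral_finsetSum _ fun n _ => ((hlam n).mul (hf n)).integrable]
  refine Finset.sum_nonpos fun n _ => ?_
  have hmeas : Measurable fun C : Mat N K => ∑ k, z C n k - φ n :=
    (Finset.measurable_fun_sum _ fun k _ => hznk n k).sub_const _
  have hind : IndepFun (fun ω => (stateAt φ η sel c r t ω).lam n)
      (fun ω => ∑ k, z (c (t + 1) ω) n k - φ n) P :=
    ((E.indepFun_cost_lam hsel t).comp hmeas (measurable_pi_apply n)).symm
  rw [hind.integral_fun_mul_eq_mul_integral (hlam n).1.aestronglyMeasurable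
    (hf n).1.aestronglyMeasurable]
  refine mul_nonpos_of_nonneg_of_nonpos (integral_nonneg fun ω => lam_nonneg _ _ t n) ?_
  have hident := (E.ident_cost (t + 1) (Finset.mem_Icc.2 ⟨by omega, by omega⟩)).map_eq
  have h := hfair n
  simp only [utilization_one] at h
  rw [← hident, integral_map (E.measurable_cost _).aemeasurable
    (Finset.measurable_fun_sum _ fun k _ => hznk n k).aestronglyMeasurable] at h
  rw [integral_sub (BoundedMeasurable.sum fun k => hZ n k).integrable (integrable_const _)]
  simpa using h

open Classical in
/-- The regret in slot `t + 1` against a fair policy, up to the failures of the lower confidence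
bounds, the optimism of the estimates on the pulled arms and the penalty terms. -/
theorem policy_welfare_sub_le (E : IsEnvironment P T r c)
    (hsel : IsMaximizingRule φ sel) (hη : 0 ≤ η) (hφ : ∀ n, φ n ∈ Set.Icc (0 : ℝ) 1)
    {z : Mat N K → Mat N K} (hz : Measurable z) (hzm : ∀ C, z C ∈ assignments N K)
    {t : ℕ} (ht : t < T) (hfair : ∀ n, ∫ C, utilization (z C) 1 n ∂P.map (c 1) ≤ φ n) :
    ∫ C, ∑ k, ∑ n, ((∫ ω, r 1 ω k ∂P) - C n k) * z C n k ∂P.map (c 1)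
        - ∫ ω, welfare (assignmentAt φ η sel c r (t + 1) ω) 1 (r (t + 1) ω) (c (t + 1) ω) ∂P
      ≤ K * (t / (t + 1) ^ 3)
        + ∫ ω, ∑ k, (estimate (t + 1) (stateAt φ η sel c r t ω) k
            - ∫ ω, r 1 ω k ∂P) * ∑ n, assignmentAt φ η sel c r (t + 1) ω n k ∂P
        - ∫ ω, ∑ n, (stateAt φ η sel c r t ω).lam n
            * (∑ k, assignmentAt φ η sel c r (t + 1) ω n k - φ n) ∂P := by
  set μ : Fin K → ℝ := fun k => ∫ ω, r 1 ω k ∂P with hμ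
  have hident := (E.ident_cost (t + 1) (Finset.mem_Icc.2 ⟨by omega, by omega⟩)).map_eq
  have hznk : ∀ n k, Measurable fun C => z C n k := fun n k =>
    (measurable_pi_apply k).comp ((measurable_pi_apply n).comp hz)
  have hZ : ∀ n k, BoundedMeasurable fun ω => z (c (t + 1) ω) n k := fun n k =>
    boundedMeasurable_of_mem_Icc (a := 0) (b := 1) ((hznk n k).comp (E.measurable_cost _))
      fun ω => ⟨nonneg_of_mem_assignments (hzm _) n k, le_one_of_mem_assignments (hzm _) n k⟩
  have hX := fun n k => E.boundedMeasurable_assignmentAt (η := η) hsel t n k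
  have hlam := E.boundedMeasurable_lam hsel hη hφ t
  have hmc : ∀ n k, BoundedMeasurable fun ω => μ k - c (t + 1) ω n k := fun n k =>
    (boundedMeasurable_const _).sub (E.boundedMeasurable_cost _ n k)
  have hS : BoundedMeasurable fun ω => ∑ k, ∑ n, (μ k - c (t + 1) ω n k) * z (c (t + 1) ω) n k :=
    BoundedMeasurable.sum fun k => BoundedMeasurable.sum fun n => (hmc n k).mul (hZ n k)
  have hW : BoundedMeasurable fun ω => ∑ k, ∑ n, (μ k - c (t + 1) ω n k)
      * assignmentAt φ η sel c r (t + 1) ω n k :=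
    BoundedMeasurable.sum fun k => BoundedMeasurable.sum fun n => (hmc n k).mul (hX n k)
  have hu : ∀ k, BoundedMeasurable fun ω =>
      if Underestimated (t + 1) (stateAt φ η sel c r t ω) k (μ k) then (1 : ℝ) else 0 := fun k =>
    boundedMeasurable_ite (E.measurableSet_underestimated hsel t k (μ k))
  have hU := BoundedMeasurable.sum (s := Finset.univ) hu
  have hG := BoundedMeasurable.sum (s := Finset.univ) fun k =>
    boundedMeasurable_gap (η := η) E hsel μ t k
  have hLX : BoundedMeasurable fun ω => ∑ n, (stateAt φ η sel c r t ω).lam n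
      * (∑ k, assignmentAt φ η sel c r (t + 1) ω n k - φ n) :=
    BoundedMeasurable.sum fun n => (hlam n).mul
      ((BoundedMeasurable.sum fun k => hX n k).sub (boundedMeasurable_const _))
  have hLZ : BoundedMeasurable fun ω => ∑ n, (stateAt φ η sel c r t ω).lam n
      * (∑ k, z (c (t + 1) ω) n k - φ n) :=
    BoundedMeasurable.sum fun n => (hlam n).mul
      ((BoundedMeasurable.sum fun k => hZ n k).sub (boundedMeasurable_const _))
  have hpath : ∀ ω, ∑ k, ∑ n, (μ k - c (t + 1) ω n k) * z (c (t + 1) ω) n k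
      ≤ ∑ k, ∑ n, (μ k - c (t + 1) ω n k) * assignmentAt φ η sel c r (t + 1) ω n k
        + ∑ k, (if Underestimated (t + 1) (stateAt φ η sel c r t ω) k (μ k) then (1 : ℝ) else 0)
        + ∑ k, (estimate (t + 1) (stateAt φ η sel c r t ω) k - μ k)
            * ∑ n, assignmentAt φ η sel c r (t + 1) ω n k
        - ∑ n, (stateAt φ η sel c r t ω).lam n
            * (∑ k, assignmentAt φ η sel c r (t + 1) ω n k - φ n)
        + ∑ n, (stateAt φ η sel c r t ω).lam n * (∑ k, z (c (t + 1) ω) n k - φ n) := by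
    intro ω
    refine welfare_comparison (hzm _) (hsel.isMax _ _ _ _ (hzm _)) (fun k => ?_) fun k => ?_
    · have hm := (mean_reward_mem E k).2
      have he := estimate_nonneg (t + 1) (s := stateAt φ η sel c r t ω)
        (fun k => avg_nonneg _ _ hsel (fun t k => (E.reward_mem t ω k).1) t k) k
      split_ifs with h
      · linarith
      · linarith [le_estimate hm h]
    · split_ifs <;> norm_num
  have hint := integral_mono (hS.integrable (P := P))
    ((((hW.add hU).add hG).sub hLX).add hLZ).integrable hpath
  rw [integral_add (((hW.add hU).add hG).sub hLX).integrable hLZ.integrable,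
    integral_sub ((hW.add hU).add hG).integrable hLX.integrable,
    integral_add (hW.add hU).integrable hG.integrable, integral_add hW.integrable hU.integrable,
    integral_finsetSum _ fun k _ => (hu k).integrable] at hint
  have hprob : ∑ k, ∫ ω, (if Underestimated (t + 1) (stateAt φ η sel c r t ω) k (μ k)
      then (1 : ℝ) else 0) ∂P ≤ K * (t / (t + 1) ^ 3) := by
    refine (Finset.sum_le_sum fun k _ => (?_ : _ ≤ (t : ℝ) / (t + 1) ^ 3)).trans (by simp)
    rw [integral_ite_one (E.measurableSet_underestimated hsel t k (μ k))]
    exact E.measureReal_underestimated_le hsel ht.le k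
  have hpol := integral_lam_mul_policy_nonpos E hsel hη hφ hz hzm ht hfair
  have hbench : ∫ C, ∑ k, ∑ n, (μ k - C n k) * z C n k ∂P.map (c 1)
      = ∫ ω, ∑ k, ∑ n, (μ k - c (t + 1) ω n k) * z (c (t + 1) ω) n k ∂P := by
    rw [← hident, integral_map (E.measurable_cost _).aemeasurable]
    refine Measurable.aestronglyMeasurable ?_
    refine Finset.measurable_fun_sum _ fun k _ => Finset.measurable_fun_sum _ fun n _ =>
      Measurable.mul ?_ (hznk n k)
    exact measurable_const.sub ((measurable_pi_apply k).comp (measurable_pi_apply n))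
  rw [integral_welfare_one E hsel ht, hbench]
  linarith

/-! ### Profit in a slot -/

/-- The principal loses at most the optimism of the estimates, as every payment is at most the
estimated reward of the assigned arm. -/
theorem neg_integral_gap_le_profit (E : IsEnvironment P T r c) (hsel : IsMaximizingRule φ sel)
    {t : ℕ} (ht : t < T) :
    -∫ ω, ∑ k, (estimate (t + 1) (stateAt φ η sel c r t ω) k - ∫ ω, r 1 ω k ∂P)
        * ∑ n, assignmentAt φ η sel c r (t + 1) ω n k ∂P
      ≤ ∫ ω, (reward (assignmentAt φ η sel c r (t + 1) ω) 1 (r (t + 1) ω)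
          - ∑ n, yHat φ η sel (fun s => c s ω) (fun s => c s ω) (fun s => r s ω) (t + 1) n) ∂P := by
  set μ : Fin K → ℝ := fun k => ∫ ω, r 1 ω k ∂P with hμ
  have hX := fun n k => E.boundedMeasurable_assignmentAt (η := η) hsel t n k
  have hR := boundedMeasurable_reward_one (η := η) E hsel t
  have he := fun k => E.boundedMeasurable_estimate (η := η) hsel t k
  have hM : BoundedMeasurable fun ω =>
      ∑ k, ∑ n, μ k * assignmentAt φ η sel c r (t + 1) ω n k :=
    BoundedMeasurable.sum fun k => BoundedMeasurable.sum fun n =>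
      (boundedMeasurable_const _).mul (hX n k)
  have hH : BoundedMeasurable fun ω => ∑ n, ∑ k, estimate (t + 1) (stateAt φ η sel c r t ω) k
      * assignmentAt φ η sel c r (t + 1) ω n k :=
    BoundedMeasurable.sum fun n => BoundedMeasurable.sum fun k => (he k).mul (hX n k)
  have hyle : ∀ ω n, yHat φ η sel (fun s => c s ω) (fun s => c s ω) (fun s => r s ω) (t + 1) n
      ≤ ∑ k, estimate (t + 1) (stateAt φ η sel c r t ω) k
          * assignmentAt φ η sel c r (t + 1) ω n k := fun ω n => by
    have hxm := xHat_mem (fun s => c s ω) (fun s => r s ω) hsel (t + 1) (η := η)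
    refine (payment_le _ _ _ _ hxm n).trans (Finset.sum_le_sum fun k _ => ?_)
    refine mul_le_mul_of_nonneg_right ?_ (nonneg_of_mem_assignments hxm n k)
    exact sub_le_self _ (lam_nonneg (fun s => c s ω) (fun s => r s ω) t n)
  have hy : ∀ n, BoundedMeasurable fun ω =>
      yHat φ η sel (fun s => c s ω) (fun s => c s ω) (fun s => r s ω) (t + 1) n := fun n => by
    obtain ⟨hl, hn, ha⟩ := measurable_state hsel (η := η) t (fun s _ => E.measurable_cost s)
      fun s _ => E.measurable_reward s
    refine boundedMeasurable_of_mem_Icc (a := 0) (b := 1)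
      (measurable_payment hl (measurable_estimate (t + 1) hn ha) (E.measurable_cost (t + 1))
        (E.measurable_assignmentAt hsel t) n) fun ω => ⟨?_, ?_⟩
    · refine le_trans (Finset.sum_nonneg fun k _ => mul_nonneg (E.cost_mem (t + 1) ω n k).1 ?_)
        (cost_le_payment (hsel.isMax _ _ _ _) n)
      exact nonneg_of_mem_assignments (hsel.mem _ _ _ _) n k
    · have hxm := xHat_mem (fun s => c s ω) (fun s => r s ω) hsel (t + 1) (η := η)
      refine (hyle ω n).trans ((Finset.sum_le_sum fun k _ => ?_).trans (hxm.2.1 n))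
      exact mul_le_of_le_one_left (nonneg_of_mem_assignments hxm n k) (estimate_le_one _ _ _)
  have hgap : ∫ ω, ∑ k, (estimate (t + 1) (stateAt φ η sel c r t ω) k - μ k)
        * ∑ n, assignmentAt φ η sel c r (t + 1) ω n k ∂P
      = ∫ ω, ∑ n, ∑ k, estimate (t + 1) (stateAt φ η sel c r t ω) k
          * assignmentAt φ η sel c r (t + 1) ω n k ∂P
        - ∫ ω, ∑ k, ∑ n, μ k * assignmentAt φ η sel c r (t + 1) ω n k ∂P := by
    rw [← integral_sub hH.integrable hM.integrable]
    refine integral_congr_ae (ae_of_all _ fun ω => ?_)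
    simp only [sub_mul, Finset.sum_sub_distrib, Finset.mul_sum]
    congr 1
    exact Finset.sum_comm
  rw [integral_sub hR.integrable (BoundedMeasurable.sum hy).integrable, integral_reward_one E hsel ht,
    hgap]
  have := integral_mono (BoundedMeasurable.sum (s := Finset.univ) hy).integrable (μ := P)
    hH.integrable fun ω => Finset.sum_le_sum fun n _ => hyle ω n
  linarith

end Expectation

/-! ### Summation over the slots -/

theorem sum_Icc_one_eq_sum_range (f : ℕ → ℝ) (T : ℕ) :
    ∑ t ∈ Finset.Icc 1 T, f t = ∑ t ∈ Finset.range T, f (t + 1) := by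
  induction T with
  | zero => simp
  | succ T ih => rw [Finset.sum_Icc_succ_top (by omega), Finset.sum_range_succ, ih]

theorem zero_policy_fair {Ω : Type*} [MeasurableSpace Ω] {P : Measure Ω} {φ : Fin N → ℝ}
    (hφ : ∀ n, φ n ∈ Set.Icc (0 : ℝ) 1) (c : Ω → Mat N K) (n : Fin N) :
    ∫ _, utilization (0 : Mat N K) 1 n ∂P.map c ≤ φ n := by
  simpa [utilization] using (hφ n).1

theorem stepSize_mul_eq {T : ℕ} {φ : Fin N → ℝ} (hT : 1 ≤ T) (hΘ : 1 ≤ bigTheta K φ) :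
    stepSize K φ T * T * bigTheta K φ / 2
      = 2 * K + √(6 * K * T * bigPhi φ * Real.log T) := by
  have hT' : (T : ℝ) ≠ 0 := by positivity
  have hΘ' : bigTheta K φ ≠ 0 := by positivity
  unfold stepSize
  field_simp
  ring

end IOL

theorem theorem2 {Ω : Type*} [MeasurableSpace Ω] (P : Measure Ω) [IsProbabilityMeasure P]
    (N K T : ℕ) (hN : 1 ≤ N) (hK : 1 ≤ K) (hT : 1 ≤ T)
    -- utilization ratios of the agents
    (φ : Fin N → ℝ) (hφ : ∀ n, φ n ∈ Set.Icc (0 : ℝ) 1)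
    -- rewards, IID over the slots `1, …, T`
    (r : ℕ → Ω → Fin K → ℝ) (hr_meas : ∀ t, Measurable (r t))
    (hr_mem : ∀ t ω k, r t ω k ∈ Set.Icc (0 : ℝ) 1)
    (hr_indep : iIndepFun r P)
    (hr_ident : ∀ t ∈ Finset.Icc 1 T, IdentDistrib (r t) (r 1) P P)
    -- costs, IID over the slots `1, …, T`
    (cmin : ℝ) (hcmin : 0 ≤ cmin)
    (c : ℕ → Ω → Fin N → Fin K → ℝ) (hc_meas : ∀ t, Measurable (c t))
    (hc_mem : ∀ t ω n k, c t ω n k ∈ Set.Icc cmin 1)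
    (hc_indep : iIndepFun c P)
    (hc_ident : ∀ t ∈ Finset.Icc 1 T, IdentDistrib (c t) (c 1) P P)
    -- the environment's rewards and the agents' costs are independent
    (hrc : IndepFun (fun ω t => r t ω) (fun ω t => c t ω) P)
    -- the mechanism's assignment rule, with any tie-breaking
    (sel : IOL.Rule N K) (hsel : IOL.IsMaximizingRule φ sel)
    -- the proposals and decisions under the mechanism, where bids are the true costs
    (x : ℕ → Ω → Fin N → Fin K → ℝ) (y a : ℕ → Ω → Fin N → ℝ)
    (hx : ∀ t ω, x t ω = IOL.xHat φ (IOL.stepSize K φ T) sel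
      (fun s => c s ω) (fun s => c s ω) (fun s => r s ω) t)
    (hy : ∀ t ω, y t ω = IOL.yHat φ (IOL.stepSize K φ T) sel
      (fun s => c s ω) (fun s => c s ω) (fun s => r s ω) t)
    (ha : ∀ t ω, a t ω = IOL.aHat φ (IOL.stepSize K φ T) sel
      (fun s => c s ω) (fun s => c s ω) (fun s => r s ω) t) :
    IOL.regret P φ r c x a T ≤ 6 * K +
        3 * √(6 * K * T * (IOL.bigPhi φ + IOL.violation P φ x a T / T) * Real.log T) ∧
      (∀ δ ∈ Set.Ioo 0 (IOL.phiMin φ),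
        IOL.violation P φ x a T ≤ IOL.bigXi K φ δ +
          IOL.bigTheta K φ ^ 2 / (4 * δ) * √(N * T / (K * IOL.bigPhi φ))) ∧
      0 ≤ IOL.profit P r x y a T + 5 * K / 2 +
        2 * √(6 * K * T * (IOL.bigPhi φ + IOL.violation P φ x a T / T) * Real.log T) := by
  have E : IOL.IsEnvironment P T r c :=
    ⟨hr_meas, hr_mem, hr_indep, hr_ident, hc_meas,
      fun t ω n k => ⟨hcmin.trans (hc_mem t ω n k).1, (hc_mem t ω n k).2⟩, hc_indep, hc_ident, hrc⟩
  have hT' : (0 : ℝ) < T := by exact_mod_cast hT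
  have hK' : (0 : ℝ) ≤ K := by positivity
  have hΘ := IOL.one_le_bigTheta hN hK hφ
  have hηpos := IOL.stepSize_pos hN hK hT hφ
  have hηT := IOL.stepSize_mul_eq (K := K) hT hΘ
  set η := IOL.stepSize K φ T with hη
  have ha1 : ∀ t ω, a t ω = 1 := fun t ω => by rw [ha, IOL.aHat_eq_one _ _ hsel]
  have hX := fun t n k => E.boundedMeasurable_assignmentAt (η := η) hsel t n k
  have hvio : IOL.violation P φ x a T = ∑ n, ∫ ω, max (∑ t ∈ Finset.range T,
      (∑ k, IOL.assignmentAt φ η sel c r (t + 1) ω n k - φ n)) 0 ∂P := by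
    simp only [IOL.violation, IOL.sum_Icc_one_eq_sum_range, ha1, hx, IOL.utilization_one]
  have hb : ∀ n, IOL.BoundedMeasurable fun ω => max (∑ t ∈ Finset.range T,
      (∑ k, IOL.assignmentAt φ η sel c r (t + 1) ω n k - φ n)) 0 := fun n =>
    (IOL.BoundedMeasurable.sum fun t => (IOL.BoundedMeasurable.sum fun k =>
      hX t n k).sub (IOL.boundedMeasurable_const _)).max_zero
  have hV0 : 0 ≤ IOL.violation P φ x a T := by
    rw [hvio]
    exact Finset.sum_nonneg fun n _ => integral_nonneg fun ω => le_max_right _ _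
  have hgap := IOL.integral_gap_le (η := η) E hsel
  rw [← hvio, show 6 * (K : ℝ) * (T * IOL.bigPhi φ + IOL.violation P φ x a T) * Real.log T
    = 6 * K * T * (IOL.bigPhi φ + IOL.violation P φ x a T / T) * Real.log T by
      field_simp] at hgap
  refine ⟨?_, ?_, ?_⟩
  · have hroot : √(6 * K * T * IOL.bigPhi φ * Real.log T)
        ≤ √(6 * K * T * (IOL.bigPhi φ + IOL.violation P φ x a T / T) * Real.log T) := by
      have : 0 ≤ IOL.violation P φ x a T / T := by positivity
      have : 0 ≤ Real.log T := Real.log_natCast_nonneg T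
      gcongr
      linarith
    have hdual : -∑ t ∈ Finset.range T, ∫ ω, ∑ n, (IOL.stateAt φ η sel c r t ω).lam n
        * (∑ k, IOL.assignmentAt φ η sel c r (t + 1) ω n k - φ n) ∂P
        ≤ 2 * K + √(6 * K * T * IOL.bigPhi φ * Real.log T) := by
      have hL : ∀ t, IOL.BoundedMeasurable fun ω => ∑ n, (IOL.stateAt φ η sel c r t ω).lam n
          * (∑ k, IOL.assignmentAt φ η sel c r (t + 1) ω n k - φ n) := fun t =>
        IOL.BoundedMeasurable.sum fun n => (E.boundedMeasurable_lam hsel hηpos.le hφ t n).mul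
          ((IOL.BoundedMeasurable.sum fun k => hX t n k).sub (IOL.boundedMeasurable_const _))
      rw [← hηT, ← integral_finsetSum _ fun t _ => (hL t).integrable, ← integral_neg]
      refine (integral_mono (IOL.BoundedMeasurable.sum hL).integrable.neg (integrable_const _)
        fun ω => IOL.neg_sum_lam_mul_le _ _ hsel hφ hηpos T).trans ?_
      simp
    have hpolicy : IOL.benchmark φ (fun k => ∫ ω, r 1 ω k ∂P) (P.map (c 1))
        ≤ (6 * K + 3 * √(6 * K * T * (IOL.bigPhi φ + IOL.violation P φ x a T / T) * Real.log T)
          + ∑ t ∈ Finset.range T, ∫ ω, IOL.welfare (IOL.assignmentAt φ η sel c r (t + 1) ω) 1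
            (r (t + 1) ω) (c (t + 1) ω) ∂P) / T := by
      refine csSup_le ⟨_, fun _ => 0, measurable_const, fun _ => IOL.zero_mem_assignments,
        IOL.zero_policy_fair hφ _, rfl⟩ ?_
      rintro _ ⟨z, hz, hzm, hfair, rfl⟩
      -- multiples of `K` used: one for underestimation, two for optimism, two for the dual regret
      have hslots := Finset.sum_le_sum fun t (ht : t ∈ Finset.range T) =>
        IOL.policy_welfare_sub_le (η := η) E hsel hηpos.le hφ hz hzm (Finset.mem_range.1 ht) hfair
      simp only [Finset.sum_sub_distrib, Finset.sum_add_distrib, ← Finset.mul_sum,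
        Finset.sum_const, Finset.card_range, nsmul_eq_mul] at hslots
      have hdev := mul_le_mul_of_nonneg_left (IOL.sum_deviation_bound_le_one T) hK'
      rw [le_div_iff₀ hT']
      linarith
    have hreg : IOL.regret P φ r c x a T
        = T * IOL.benchmark φ (fun k => ∫ ω, r 1 ω k ∂P) (P.map (c 1))
          - ∑ t ∈ Finset.range T, ∫ ω, IOL.welfare (IOL.assignmentAt φ η sel c r (t + 1) ω) 1
            (r (t + 1) ω) (c (t + 1) ω) ∂P := by
      simp only [IOL.regret, IOL.sum_Icc_one_eq_sum_range, ha1, hx, Finset.sum_sub_distrib,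
        Finset.sum_const, Nat.card_Icc, Nat.add_sub_cancel, nsmul_eq_mul]
    rw [le_div_iff₀ hT'] at hpolicy
    rw [hreg]
    linarith
  · intro δ hδ
    rw [hvio, ← integral_finsetSum _ fun n _ => (hb n).integrable]
    refine (integral_mono (IOL.BoundedMeasurable.sum hb).integrable (integrable_const _) fun ω =>
      IOL.violation_path_le _ _ hN hK hT hsel hφ (fun t n k => (E.cost_mem t ω n k).1) hδ
        hη).trans ?_
    simp
  · have hpro : IOL.profit P r x y a T = ∑ t ∈ Finset.range T,
        ∫ ω, (IOL.reward (IOL.assignmentAt φ η sel c r (t + 1) ω) 1 (r (t + 1) ω)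
          - ∑ n, IOL.yHat φ η sel (fun s => c s ω) (fun s => c s ω) (fun s => r s ω)
              (t + 1) n) ∂P := by
      simp only [IOL.profit, IOL.sum_Icc_one_eq_sum_range, ha1, hx, hy, Pi.one_apply, one_mul]
    have hslots := Finset.sum_le_sum fun t (ht : t ∈ Finset.range T) =>
      IOL.neg_integral_gap_le_profit (η := η) E hsel (Finset.mem_range.1 ht)
    rw [Finset.sum_neg_distrib] at hslots
    rw [hpro]
    linarith
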